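/- Let $q\ge 1$, $k\ge 0$ and $0\le \ell<m$ be integers, and let $A$ and $B$ be systems of $m$ qudits each, with local dimension $q$, so that $\mathcal H_A\cong\mathcal H_B\cong(\mathbb C^q)^{\otimes m}$. Equip the space $\mathcal L(A^kB^k)$ of linear operators on $k$ copies $(\mathcal H_A\otimes\mathcal H_B)^{\otimes k}$ with the Hilbert–Schmidt norm $\|X\|_2=\sqrt{\operatorname{tr}(X^\dagger X)}$. For a subsystem $S$ of $AB$ (a subset of the qudits of one copy), let $$\mathcal T_S(X)=\int_{\mathcal U(S)} U^{\otimes k}\,X\,(U^{\dagger})^{\otimes k}\,dU$$ be the $k$-fold twirl over $S$, where $dU$ is the normalized Haar measure on the unitary group of $S$ and $\mathcal T_S$ acts as the identity on the remaining qudits. Put $$\mathcal P=\mathcal T_A\otimes\mathcal T_B,\qquad \mathcal Q_{\mathrm{ct}}=\mathcal T_{A^\ell B^\ell},\qquad \mathcal R=\mathcal T_{AB},$$ where $A^\ell B^\ell$ consists of the first $\ell$ qudits of $A$ and the first $\ell$ qudits of $B$ (in every copy). The subspace angle between the images of $\mathcal P$ and $\mathcal Q_{\mathrm{ct}}$ is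 $$c(\operatorname{im}\mathcal P,\operatorname{im}\mathcal Q_{\mathrm{ct}})=\|\mathcal Q_{\mathrm{ct}}\mathcal P-\mathcal R\|_{2\to2}=\sup_{X\ne0}\frac{\|\mathcal Q_{\mathrm{ct}}\mathcal P(X)-\mathcal R(X)\|_2}{\|X\|_2}.$$ Assume that $k\le\min\{q^{2\ell},q^m\}$, $k^2<2q^{2\ell}$ and $k^2\neq 2q^m$. Then $$c(\operatorname{im}\mathcal P,\operatorname{im}\mathcal Q_{\mathrm{ct}})^2\le acg\,q^{-4\ell k}\,k!^2\binom{q^{2\ell}+k-1}{k}^2-2ab\,q^{-4mk}\,k!^2\binom{q^{2m}+k-1}{k}^2+ab\,q^{-4mk}\,k!^4\binom{q^m+k-1}{k}^4,$$ with the constants $$a=\Bigl(1-\frac{k^2}{2q^m}\Bigr)^{-2},\qquad b=\exp\Bigl(-\frac{k^2}{2q^{2m}}\Bigr),\qquad c=\Bigl(1-\frac{k^2}{2q^{2\ell}}\Bigr)^{-1},\qquad g=\exp\Bigl(\frac{k^2}{q^{m-\ell}}\Bigr).$$ -/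

import Mathlib

open scoped Kronecker

noncomputable section

namespace CrossTwirl

/-! ### Haar probability measure on a unitary group -/

section Haar

variable {n : Type*} [Fintype n] [DecidableEq n]

instance unitaryGroup_measurableSpace : MeasurableSpace (Matrix.unitaryGroup n ℂ) := borel _

instance unitaryGroup_borelSpace : BorelSpace (Matrix.unitaryGroup n ℂ) := ⟨rfl⟩

instance unitaryGroup_compactSpace : CompactSpace (Matrix.unitaryGroup n ℂ) := by
  apply isCompact_iff_compactSpace.mp
  have hK : IsCompact
      (Set.pi Set.univ fun _ : n => Set.pi Set.univ fun _ : n => Metric.closedBall (0 : ℂ) 1) :=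
    isCompact_univ_pi fun _ => isCompact_univ_pi fun _ => isCompact_closedBall _ _
  refine IsCompact.of_isClosed_subset (X := Matrix n n ℂ) hK ?_ ?_
  · have h : (Matrix.unitaryGroup n ℂ : Set (Matrix n n ℂ)) = {M | M * star M = 1} := by
      ext M
      exact Matrix.mem_unitaryGroup_iff
    rw [h]
    exact isClosed_eq (by fun_prop) continuous_const
  · intro M hM i _ j _
    simpa using entry_norm_bound_of_unitary hM i j

/-- The normalized Haar measure on the unitary group `U(n)`. -/
def haarU : MeasureTheory.Measure (Matrix.unitaryGroup n ℂ) :=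
  MeasureTheory.Measure.haarMeasure ⊤

instance haarU_isProbabilityMeasure :
    MeasureTheory.IsProbabilityMeasure (haarU (n := n)) :=
  ⟨MeasureTheory.Measure.haarMeasure_self⟩

end Haar

/-! ### Twirls

One copy of the system consists of qudits of local dimension `q` placed at sites `σ`, so that its
computational basis is `σ → Fin q`. Operators on `k` copies are matrices indexed by
`Fin k → (σ → Fin q)`. -/

/-- Operators on `k` copies of a system of `q`-dimensional qudits at the sites `σ`. -/
abbrev Op (σ : Type*) (q k : ℕ) : Type _ :=
  Matrix (Fin k → σ → Fin q) (Fin k → σ → Fin q) ℂ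

/-- The `k`-fold tensor power `M ⊗ ⋯ ⊗ M` of a matrix. -/
def tensorPow {ι : Type*} (k : ℕ) (M : Matrix ι ι ℂ) : Matrix (Fin k → ι) (Fin k → ι) ℂ :=
  Matrix.of fun x y => ∏ i, M (x i) (y i)

section Twirl

variable {σ : Type*} [Fintype σ] [DecidableEq σ]

/-- An operator `U` on the qudits at the sites in `S`, viewed as the operator `U ⊗ 1` on all
qudits. -/
def embed (S : Finset σ) {q : ℕ}
    (U : Matrix ({s // s ∈ S} → Fin q) ({s // s ∈ S} → Fin q) ℂ) :
    Matrix (σ → Fin q) (σ → Fin q) ℂ :=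
  (U ⊗ₖ (1 : Matrix ({s // s ∉ S} → Fin q) ({s // s ∉ S} → Fin q) ℂ)).submatrix
    (Equiv.piEquivPiSubtypeProd (· ∈ S) fun _ => Fin q)
    (Equiv.piEquivPiSubtypeProd (· ∈ S) fun _ => Fin q)

/-- `U^{⊗k} X (U†)^{⊗k}` for a unitary `U` acting on the sites in `S` of each of the `k` copies. -/
def conjAction (S : Finset σ) {q k : ℕ}
    (U : Matrix.unitaryGroup ({s // s ∈ S} → Fin q) ℂ) (X : Op σ q k) : Op σ q k :=
  tensorPow k (embed S U.1) * X * tensorPow k (embed S (U.1.conjTranspose))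

theorem continuous_conjAction (S : Finset σ) {q k : ℕ} (X : Op σ q k) :
    Continuous fun U : Matrix.unitaryGroup ({s // s ∈ S} → Fin q) ℂ => conjAction S U X := by
  have h : ∀ f : Matrix.unitaryGroup ({s // s ∈ S} → Fin q) ℂ →
      Matrix ({s // s ∈ S} → Fin q) ({s // s ∈ S} → Fin q) ℂ, Continuous f →
      Continuous fun U => tensorPow k (embed S (f U)) := by
    intro f hf
    refine continuous_matrix fun x y => ?_
    simp only [tensorPow, embed, Matrix.of_apply, Matrix.submatrix_apply, Matrix.kroneckerMap_apply]
    refine continuous_finsetProd _ fun i _ => ?_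
    exact (hf.matrix_elem _ _).mul continuous_const
  exact ((h _ continuous_subtype_val).matrix_mul continuous_const).matrix_mul
    (h _ continuous_subtype_val.matrix_conjTranspose)

theorem integrable_conjAction (S : Finset σ) {q k : ℕ} (X : Op σ q k)
    (x y : Fin k → σ → Fin q) :
    MeasureTheory.Integrable
      (fun U : Matrix.unitaryGroup ({s // s ∈ S} → Fin q) ℂ => conjAction S U X x y) haarU :=
  ((continuous_conjAction S X).matrix_elem x y).integrable_of_hasCompactSupport
    (HasCompactSupport.of_compactSpace _)

/-- The `k`-fold Haar twirl over the qudits at the sites in `S`,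
`X ↦ ∫ U^{⊗k} X (U†)^{⊗k} dU` (entrywise integral), acting as the identity channel on the remaining
qudits. -/
def twirl (S : Finset σ) (q k : ℕ) : Op σ q k →ₗ[ℂ] Op σ q k where
  toFun X := Matrix.of fun x y =>
    ∫ U : Matrix.unitaryGroup ({s // s ∈ S} → Fin q) ℂ, conjAction S U X x y ∂haarU
  map_add' X Y := by
    ext x y
    simp only [Matrix.of_apply, Matrix.add_apply]
    rw [← MeasureTheory.integral_add (integrable_conjAction S X x y)
      (integrable_conjAction S Y x y)]
    simp only [conjAction, Matrix.mul_add, Matrix.add_mul, Matrix.add_apply]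
  map_smul' c X := by
    ext x y
    simp only [Matrix.of_apply, Matrix.smul_apply, RingHom.id_apply]
    rw [← MeasureTheory.integral_smul]
    simp only [conjAction, Matrix.mul_smul, Matrix.smul_mul, Matrix.smul_apply]

end Twirl

/-! ### The bipartite protocol

The sites are `Fin m ⊕ Fin m`: the left summand is `A`, the right summand is `B`. -/

/-- The qudits of the system `A`. -/
def sitesA (m : ℕ) : Finset (Fin m ⊕ Fin m) := Finset.univ.filter fun s => s.isLeft

/-- The qudits of the system `B`. -/
def sitesB (m : ℕ) : Finset (Fin m ⊕ Fin m) := Finset.univ.filter fun s => s.isRight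

/-- The first `l` qudits of `A` together with the first `l` qudits of `B`. -/
def sitesFirst (m l : ℕ) : Finset (Fin m ⊕ Fin m) :=
  Finset.univ.filter fun s => (Sum.elim (fun i => i) (fun i => i) s : Fin m).val < l

/-- `T_A ⊗ T_B = (T_A ⊗ id) ∘ (id ⊗ T_B)`. -/
def productTwirl (q m k : ℕ) : Op (Fin m ⊕ Fin m) q k →ₗ[ℂ] Op (Fin m ⊕ Fin m) q k :=
  twirl (sitesA m) q k ∘ₗ twirl (sitesB m) q k

/-- The crosstwirl: the joint twirl over the first `l` qudits of `A` and of `B`. -/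
def crossTwirl (q m l k : ℕ) : Op (Fin m ⊕ Fin m) q k →ₗ[ℂ] Op (Fin m ⊕ Fin m) q k :=
  twirl (sitesFirst m l) q k

/-- The full twirl `T_{AB}`. -/
def fullTwirl (q m k : ℕ) : Op (Fin m ⊕ Fin m) q k →ₗ[ℂ] Op (Fin m ⊕ Fin m) q k :=
  twirl Finset.univ q k

/-- The operator norm `sup_{X ≠ 0} ‖Φ X‖ / ‖X‖` of a linear map on a finite-dimensional space. -/
def opNorm {E : Type*} [NormedAddCommGroup E] [NormedSpace ℂ E] [FiniteDimensional ℂ E]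
    (Φ : E →ₗ[ℂ] E) : ℝ :=
  ‖LinearMap.toContinuousLinearMap Φ‖

section SubspaceAngle

attribute [local instance] Matrix.frobeniusNormedAddCommGroup Matrix.frobeniusNormedSpace

/-- The subspace angle `c(im P, im Q) = ‖Q P - R‖_{2→2}` of the product twirl `P` and the
crosstwirl `Q`, where `R` is the full twirl; the norm is induced by the Hilbert-Schmidt
(Frobenius) norm on operators. -/
def subspaceAngle (q m l k : ℕ) : ℝ :=
  opNorm (crossTwirl q m l k ∘ₗ productTwirl q m k - fullTwirl q m k)

end SubspaceAngle

end CrossTwirl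

end

open scoped Kronecker

noncomputable section

namespace CrossTwirl

/-! ### Tensor powers of matrices. -/

section TensorPow

/-! Put d = q^(2l), D = q^m and T = q^(m-l), so that T²d = D². Since k ≤ D, Schur–Weyl duality on A
and then on B writes every element of im P as a combination of operators π_A ⊗ τ_B, and
near-orthogonality of permutation operators bounds the coefficients by the norm
(`exists_eq_sum_permOp`). Terms with π = τ are fixed by both Q and R, so Q - R kills them. For the
remaining part Y, ‖(Q - R)Y‖ ≤ ‖QY‖, because RY is the orthogonal projection of QY.

No Weingarten calculus is needed to bound QY. Near-orthogonality on the crosstwirled sites bounds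
‖QY‖² by the squared partial overlaps of Y with the permutation operators there, divided by a
falling factorial of d (`descFactorial_mul_hsSq_twirl_le`). Each overlap is a weighted sum of
permutation operators on the other sites, and a Schur test bounds it by row sums of a Gram matrix,
which Burnside's lemma evaluates as rising factorials. For π ≠ τ the squared weights add up to at
most the square of a full row sum minus d^(2k) (`sum_agreeCount_mul_agreeCount_le`); this
subtraction is the gain.

The outcome is the sharper bound acg(A₁² - 1), with A₁ the k-th rising factorial of d over d^k. The
other two terms of the stated bound contribute at least -a, and cg ≥ 1, so it follows. If k² > 2q^m,
the coefficient estimate is void, but the right-hand side is then at least 1 while the angle is at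
most 1. -/

theorem tensorPow_mul {ι : Type*} [Fintype ι] (k : ℕ) (M N : Matrix ι ι ℂ) :
    tensorPow k (M * N) = tensorPow k M * tensorPow k N := by
  ext x y
  simp only [tensorPow, Matrix.of_apply, Matrix.mul_apply]
  rw [Finset.prod_univ_sum, Fintype.piFinset_univ]
  simp only [Finset.prod_mul_distrib]

theorem tensorPow_one {ι : Type*} [DecidableEq ι] (k : ℕ) : tensorPow k (1 : Matrix ι ι ℂ) = 1 := by
  ext x y
  simp only [tensorPow, Matrix.of_apply, Matrix.one_apply, Finset.prod_ite_zero,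
    Finset.mem_univ, forall_const, Finset.prod_const_one, funext_iff]

theorem tensorPow_conjTranspose {ι : Type*} (k : ℕ) (M : Matrix ι ι ℂ) :
    tensorPow k M.conjTranspose = (tensorPow k M).conjTranspose := by
  ext x y
  simp [tensorPow, Matrix.conjTranspose_apply]

end TensorPow

/-! ### The Hilbert–Schmidt inner product. -/

section HilbertSchmidt

variable {ι : Type*} [Fintype ι]

/-- The Hilbert–Schmidt inner product, as a linear functional in its second argument. -/
def hsInner (X : Matrix ι ι ℂ) : Matrix ι ι ℂ →ₗ[ℂ] ℂ :=
  Matrix.traceLinearMap ι ℂ ℂ ∘ₗ LinearMap.mulLeft ℂ X.conjTranspose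

theorem hsInner_apply (X Y : Matrix ι ι ℂ) :
    hsInner X Y = (X.conjTranspose * Y).trace := rfl

theorem hsInner_eq_sum (X Y : Matrix ι ι ℂ) :
    hsInner X Y = ∑ y, ∑ x, star (X x y) * Y x y := by
  simp [hsInner_apply, Matrix.trace, Matrix.mul_apply]

/-- The squared Hilbert–Schmidt norm. -/
def hsSq (X : Matrix ι ι ℂ) : ℝ := ∑ y, ∑ x, ‖X x y‖ ^ 2

theorem hsSq_nonneg (X : Matrix ι ι ℂ) : 0 ≤ hsSq X := by
  unfold hsSq; positivity

theorem hsInner_self (X : Matrix ι ι ℂ) : hsInner X X = (hsSq X : ℂ) := by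
  simp [hsInner_eq_sum, hsSq, Complex.conj_mul']

theorem eq_zero_of_hsSq_eq_zero {X : Matrix ι ι ℂ} (h : hsSq X = 0) : X = 0 := by
  ext x y
  have h1 := (Finset.sum_eq_zero_iff_of_nonneg (fun y _ => by positivity)).1 h y (Finset.mem_univ _)
  have h2 := (Finset.sum_eq_zero_iff_of_nonneg (fun y _ => by positivity)).1 h1 x
    (Finset.mem_univ _)
  simpa using h2

theorem hsInner_sub_left (X Y Z : Matrix ι ι ℂ) :
    hsInner (X - Y) Z = hsInner X Z - hsInner Y Z := by
  simp [hsInner_apply, Matrix.sub_mul]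

theorem star_hsInner (X Y : Matrix ι ι ℂ) : star (hsInner X Y) = hsInner Y X := by
  simp [hsInner_eq_sum, mul_comm]

theorem norm_hsInner_sq_le (X Y : Matrix ι ι ℂ) :
    ‖hsInner X Y‖ ^ 2 ≤ hsSq X * hsSq Y := by
  rw [hsInner_eq_sum, ← Finset.sum_product']
  refine (pow_le_pow_left₀ (norm_nonneg _) (norm_sum_le _ _) 2).trans ?_
  simp only [norm_mul, norm_star]
  refine (Finset.sum_mul_sq_le_sq_mul_sq _ _ _).trans (le_of_eq ?_)
  simp only [hsSq, ← Finset.sum_product']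

theorem hsInner_mul_mul (X L Y R : Matrix ι ι ℂ) :
    hsInner X (L * Y * R) = hsInner (L.conjTranspose * X * R.conjTranspose) Y := by
  simp only [hsInner_apply, Matrix.conjTranspose_mul, Matrix.conjTranspose_conjTranspose]
  rw [← Matrix.mul_assoc, ← Matrix.mul_assoc, Matrix.trace_mul_comm]
  simp only [Matrix.mul_assoc]

end HilbertSchmidt

/-! ### Twirls as orthogonal projections onto commutants. -/

section Embed

variable {σ : Type*} [Fintype σ] [DecidableEq σ] {q : ℕ}

theorem embed_mul (S : Finset σ) (U V : Matrix ({s // s ∈ S} → Fin q) ({s // s ∈ S} → Fin q) ℂ) :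
    embed S (U * V) = embed S U * embed S V := by
  unfold embed
  rw [Matrix.submatrix_mul_equiv, ← Matrix.mul_kronecker_mul, Matrix.one_mul]

theorem embed_one (S : Finset σ) :
    embed S (1 : Matrix ({s // s ∈ S} → Fin q) ({s // s ∈ S} → Fin q) ℂ) = 1 := by
  unfold embed
  rw [Matrix.one_kronecker_one, Matrix.submatrix_one_equiv]

theorem embed_conjTranspose (S : Finset σ)
    (U : Matrix ({s // s ∈ S} → Fin q) ({s // s ∈ S} → Fin q) ℂ) :
    embed S U.conjTranspose = (embed S U).conjTranspose := by
  unfold embed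
  rw [Matrix.conjTranspose_submatrix, Matrix.conjTranspose_kronecker, Matrix.conjTranspose_one]

theorem embed_apply (S : Finset σ)
    (U : Matrix ({s // s ∈ S} → Fin q) ({s // s ∈ S} → Fin q) ℂ) (x y : σ → Fin q) :
    embed S U x y = U (fun s => x s) (fun s => y s) * if ∀ s ∉ S, x s = y s then 1 else 0 := by
  simp only [embed, Matrix.submatrix_apply, Matrix.kroneckerMap_apply, Matrix.one_apply,
    Equiv.piEquivPiSubtypeProd_apply, funext_iff, Subtype.forall]

variable {k : ℕ}

/-- The action `U^{⊗k} ⊗ 1` of an operator `U` on the sites in `S`. -/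
def siteRep (S : Finset σ) (k : ℕ)
    (U : Matrix ({s // s ∈ S} → Fin q) ({s // s ∈ S} → Fin q) ℂ) : Op σ q k :=
  tensorPow k (embed S U)

theorem siteRep_mul (S : Finset σ)
    (U V : Matrix ({s // s ∈ S} → Fin q) ({s // s ∈ S} → Fin q) ℂ) :
    siteRep S k (U * V) = siteRep S k U * siteRep S k V := by
  rw [siteRep, embed_mul, tensorPow_mul, siteRep, siteRep]

theorem siteRep_conjTranspose (S : Finset σ)
    (U : Matrix ({s // s ∈ S} → Fin q) ({s // s ∈ S} → Fin q) ℂ) :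
    siteRep S k U.conjTranspose = (siteRep S k U).conjTranspose := by
  rw [siteRep, embed_conjTranspose, tensorPow_conjTranspose, siteRep]

theorem siteRep_one (S : Finset σ) :
    siteRep S k (1 : Matrix ({s // s ∈ S} → Fin q) ({s // s ∈ S} → Fin q) ℂ) = 1 := by
  rw [siteRep, embed_one, tensorPow_one]

theorem siteRep_mul_conjTranspose (S : Finset σ)
    (U : Matrix.unitaryGroup ({s // s ∈ S} → Fin q) ℂ) :
    siteRep S k U.1 * (siteRep S k U.1).conjTranspose = 1 := by
  rw [← siteRep_conjTranspose, ← siteRep_mul, ← siteRep_one (k := k) S]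
  congr 1
  exact Matrix.mem_unitaryGroup_iff.1 U.2

theorem siteRep_conjTranspose_mul (S : Finset σ)
    (U : Matrix.unitaryGroup ({s // s ∈ S} → Fin q) ℂ) :
    (siteRep S k U.1).conjTranspose * siteRep S k U.1 = 1 := by
  rw [← siteRep_conjTranspose, ← siteRep_mul, ← siteRep_one (k := k) S]
  congr 1
  exact Matrix.mem_unitaryGroup_iff'.1 U.2

theorem conjAction_eq (S : Finset σ) (U : Matrix.unitaryGroup ({s // s ∈ S} → Fin q) ℂ)
    (X : Op σ q k) :
    conjAction S U X = siteRep S k U.1 * X * (siteRep S k U.1).conjTranspose := by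
  rw [← siteRep_conjTranspose]; rfl

/-- `X` commutes with `U^{⊗k}` for all unitaries `U` on the sites in `S`. -/
def IsTwirlInvariant (S : Finset σ) (X : Op σ q k) : Prop :=
  ∀ U : Matrix.unitaryGroup ({s // s ∈ S} → Fin q) ℂ, siteRep S k U.1 * X = X * siteRep S k U.1

theorem isTwirlInvariant_iff_conjAction (S : Finset σ) (X : Op σ q k) :
    IsTwirlInvariant S X ↔
      ∀ U : Matrix.unitaryGroup ({s // s ∈ S} → Fin q) ℂ, conjAction S U X = X := by
  refine forall_congr' fun U => ?_
  rw [conjAction_eq]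
  constructor
  · intro h
    rw [h, Matrix.mul_assoc, siteRep_mul_conjTranspose, Matrix.mul_one]
  · intro h
    conv_rhs => rw [← h]
    rw [Matrix.mul_assoc, siteRep_conjTranspose_mul, Matrix.mul_one]

theorem IsTwirlInvariant.conjTranspose_conj {S : Finset σ} {X : Op σ q k}
    (h : IsTwirlInvariant S X) (U : Matrix.unitaryGroup ({s // s ∈ S} → Fin q) ℂ) :
    (siteRep S k U.1).conjTranspose * X * siteRep S k U.1 = X := by
  rw [Matrix.mul_assoc, ← h U, ← Matrix.mul_assoc, siteRep_conjTranspose_mul, Matrix.one_mul]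

instance haarU_isMulLeftInvariant {n : Type*} [Fintype n] [DecidableEq n] :
    MeasureTheory.Measure.IsMulLeftInvariant (haarU (n := n)) := by
  unfold haarU; infer_instance

theorem twirl_apply_apply (S : Finset σ) (X : Op σ q k) (x y : Fin k → σ → Fin q) :
    twirl S q k X x y =
      ∫ U : Matrix.unitaryGroup ({s // s ∈ S} → Fin q) ℂ, conjAction S U X x y ∂haarU := rfl

/-- Expanding the functional in matrix units reduces to the entrywise definition of the integral.
Invariance and adjointness of the twirl come from particular choices of `φ`. -/
theorem linear_twirl (S : Finset σ) (X : Op σ q k) (φ : Op σ q k →ₗ[ℂ] ℂ) :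
    φ (twirl S q k X) =
      ∫ U : Matrix.unitaryGroup ({s // s ∈ S} → Fin q) ℂ, φ (conjAction S U X) ∂haarU := by
  have h : ∀ Y : Op σ q k, φ Y = ∑ x, ∑ y, Y x y * φ (Matrix.single x y 1) := by
    intro Y
    conv_lhs => rw [Matrix.matrix_eq_sum_single Y]
    simp only [map_sum]
    refine Finset.sum_congr rfl fun x _ => Finset.sum_congr rfl fun y _ => ?_
    rw [← smul_eq_mul, ← map_smul, Matrix.smul_single, smul_eq_mul, mul_one]
  simp only [h (conjAction S _ X)]
  rw [h, MeasureTheory.integral_finsetSum _ fun x _ =>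
    MeasureTheory.integrable_finsetSum _ fun y _ =>
      (integrable_conjAction S X x y).mul_const _]
  refine Finset.sum_congr rfl fun x _ => ?_
  rw [MeasureTheory.integral_finsetSum _ fun y _ => (integrable_conjAction S X x y).mul_const _]
  refine Finset.sum_congr rfl fun y _ => ?_
  rw [MeasureTheory.integral_mul_const, twirl_apply_apply]

/-- The linear functional `X ↦ (L X R)_{xy}`. -/
def entryMulMul {ι : Type*} [Fintype ι] (L R : Matrix ι ι ℂ) (x y : ι) :
    Matrix ι ι ℂ →ₗ[ℂ] ℂ where
  toFun X := (L * X * R) x y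
  map_add' X Y := by simp [Matrix.mul_add, Matrix.add_mul]
  map_smul' c X := by simp

/-- Left invariance of Haar measure absorbs a further conjugation by `V`. -/
theorem isTwirlInvariant_twirl (S : Finset σ) (X : Op σ q k) :
    IsTwirlInvariant S (twirl S q k X) := by
  rw [isTwirlInvariant_iff_conjAction]
  intro V
  ext x y
  rw [conjAction_eq]
  refine (linear_twirl S X (entryMulMul (siteRep S k V.1) (siteRep S k V.1).conjTranspose x y)).trans ?_
  rw [twirl_apply_apply,
    ← MeasureTheory.integral_mul_left_eq_self (fun U => conjAction S U X x y) V]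
  refine MeasureTheory.integral_congr_ae (Filter.Eventually.of_forall fun U => ?_)
  simp only [entryMulMul, LinearMap.coe_mk, AddHom.coe_mk, conjAction_eq, Submonoid.coe_mul,
    siteRep_mul, Matrix.conjTranspose_mul, Matrix.mul_assoc]

theorem twirl_eq_self {S : Finset σ} {X : Op σ q k} (h : IsTwirlInvariant S X) :
    twirl S q k X = X := by
  ext x y
  rw [isTwirlInvariant_iff_conjAction] at h
  simp [twirl_apply_apply, h]

/-- Conjugation moves to the other side of the inner product, where `Z` absorbs it. This stands in
for self-adjointness of the twirl. -/
theorem hsInner_twirl {S : Finset σ} {Z : Op σ q k} (h : IsTwirlInvariant S Z) (Y : Op σ q k) :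
    hsInner Z (twirl S q k Y) = hsInner Z Y := by
  rw [linear_twirl]
  have : ∀ U : Matrix.unitaryGroup ({s // s ∈ S} → Fin q) ℂ,
      hsInner Z (conjAction S U Y) = hsInner Z Y := by
    intro U
    rw [conjAction_eq, hsInner_mul_mul, Matrix.conjTranspose_conjTranspose, h.conjTranspose_conj]
  simp [this]

/-- With Z the twirl of Y, ‖Z‖² = ⟨Z, Y⟩, and Cauchy–Schwarz finishes. -/
theorem hsSq_twirl_le (S : Finset σ) (Y : Op σ q k) : hsSq (twirl S q k Y) ≤ hsSq Y := by
  have h1 := norm_hsInner_sq_le (twirl S q k Y) Y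
  rw [← hsInner_twirl (isTwirlInvariant_twirl S Y), hsInner_self, Complex.norm_real,
    Real.norm_of_nonneg (hsSq_nonneg _)] at h1
  rcases (hsSq_nonneg (twirl S q k Y)).eq_or_lt with h0 | h0
  · rw [← h0]; exact hsSq_nonneg _
  · nlinarith

/-- Configurations on the complement of `S`, identified with configurations on `T`. -/
def complEquiv (S T : Finset σ) (hST : ∀ s, s ∉ S ↔ s ∈ T) (q : ℕ) :
    ({s // s ∉ S} → Fin q) ≃ ({s // s ∈ T} → Fin q) :=
  (Equiv.subtypeEquivRight hST).arrowCongr (Equiv.refl _)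

theorem embed_eq_one_kronecker {S T : Finset σ} (hST : ∀ s, s ∉ S ↔ s ∈ T)
    (V : Matrix ({s // s ∈ T} → Fin q) ({s // s ∈ T} → Fin q) ℂ) :
    embed T V =
      ((1 : Matrix ({s // s ∈ S} → Fin q) ({s // s ∈ S} → Fin q) ℂ) ⊗ₖ
        V.submatrix (complEquiv S T hST q) (complEquiv S T hST q)).submatrix
      (Equiv.piEquivPiSubtypeProd (· ∈ S) fun _ => Fin q)
      (Equiv.piEquivPiSubtypeProd (· ∈ S) fun _ => Fin q) := by
  ext x y
  simp only [embed_apply, Matrix.submatrix_apply, Matrix.kroneckerMap_apply, Matrix.one_apply,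
    Equiv.piEquivPiSubtypeProd_apply, funext_iff, Subtype.forall, ← hST, not_not]
  rw [mul_comm]
  rfl

/-- Actions on complementary sites commute. Hence the twirl over A keeps the invariance already
produced by the twirl over B. -/
theorem isTwirlInvariant_twirl_of_compl {S T : Finset σ} (hST : ∀ s, s ∉ S ↔ s ∈ T) {X : Op σ q k}
    (h : IsTwirlInvariant T X) : IsTwirlInvariant T (twirl S q k X) := by
  rw [isTwirlInvariant_iff_conjAction] at h ⊢
  intro V
  ext x y
  rw [conjAction_eq]
  refine (linear_twirl S X (entryMulMul (siteRep T k V.1) (siteRep T k V.1).conjTranspose x y)).trans ?_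
  rw [twirl_apply_apply]
  refine MeasureTheory.integral_congr_ae (Filter.Eventually.of_forall fun U => ?_)
  have hc : siteRep T k V.1 * siteRep S k U.1 = siteRep S k U.1 * siteRep T k V.1 := by
    simp only [siteRep, ← tensorPow_mul]
    rw [embed_eq_one_kronecker hST, embed, Matrix.submatrix_mul_equiv, Matrix.submatrix_mul_equiv,
      ← Matrix.mul_kronecker_mul, ← Matrix.mul_kronecker_mul]
    simp only [Matrix.one_mul, Matrix.mul_one]
  have hV := h V
  rw [conjAction_eq] at hV
  simp only [entryMulMul, LinearMap.coe_mk, AddHom.coe_mk, conjAction_eq]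
  conv_rhs => rw [← hV]
  have hc' := congrArg Matrix.conjTranspose hc
  simp only [Matrix.conjTranspose_mul] at hc'
  simp only [← Matrix.mul_assoc, hc]
  simp only [Matrix.mul_assoc, hc']

end Embed

/-! ### Schur–Weyl duality in the stable range. -/

section SchurWeyl

/-- Commutation with tensor powers is a polynomial condition: along a linear family of matrices it
extends from a product of infinite sets to all complex parameters. -/
theorem commute_tensorPow_of_infinite {I J : Type*} [Fintype I] [Fintype J] {k : ℕ} (X : Matrix (Fin k → I) (Fin k → I) ℂ)
    (B : J → Matrix I I ℂ) (s : J → Set ℂ) (hs : ∀ j, (s j).Infinite)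
    (h : ∀ u : J → ℂ, (∀ j, u j ∈ s j) →
      tensorPow k (∑ j, u j • B j) * X = X * tensorPow k (∑ j, u j • B j)) (u : J → ℂ) :
    tensorPow k (∑ j, u j • B j) * X = X * tensorPow k (∑ j, u j • B j) := by
  ext x y
  let g : I → I → MvPolynomial J ℂ := fun a b => ∑ j, MvPolynomial.X j * MvPolynomial.C (B j a b)
  let p : MvPolynomial J ℂ := ∑ z, (∏ i, g (x i) (z i)) * MvPolynomial.C (X z y)
  let r : MvPolynomial J ℂ := ∑ z, MvPolynomial.C (X x z) * ∏ i, g (z i) (y i)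
  have hg : ∀ (u : J → ℂ) a b, MvPolynomial.eval u (g a b) = (∑ j, u j • B j) a b := by
    intro u a b
    simp [g, Matrix.sum_apply]
  have hp : ∀ u : J → ℂ, MvPolynomial.eval u p = (tensorPow k (∑ j, u j • B j) * X) x y := by
    intro u
    simp only [p, map_sum, map_mul, map_prod, hg, MvPolynomial.eval_C]
    rfl
  have hr : ∀ u : J → ℂ, MvPolynomial.eval u r = (X * tensorPow k (∑ j, u j • B j)) x y := by
    intro u
    simp only [r, map_sum, map_mul, map_prod, hg, MvPolynomial.eval_C]
    rfl
  -- Each entry of the two sides is a polynomial in the parameters, and polynomials agreeing on a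
  -- product of infinite sets are equal.
  have hpr : p = r := MvPolynomial.funext_set s hs fun v hv => by
    rw [hp, hr, h v fun j => hv j (Set.mem_univ j)]
  rw [← hp, ← hr, hpr]

variable {I : Type*} [Fintype I] [DecidableEq I] {k : ℕ}

variable {X : Matrix (Fin k → I) (Fin k → I) ℂ}

theorem infinite_unit_circle : {z : ℂ | ‖z‖ = 1}.Infinite := by
  refine Set.Infinite.of_image Complex.re ((Set.Icc_infinite (zero_lt_one (α := ℝ))).mono ?_)
  rintro r ⟨h0, h1⟩
  refine ⟨⟨r, √(1 - r ^ 2)⟩, ?_, rfl⟩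
  have h2 : 0 ≤ 1 - r ^ 2 := by nlinarith
  change ‖_‖ = 1
  rw [Complex.norm_def, Complex.normSq_mk, Real.mul_self_sqrt h2]
  rw [show r * r + (1 - r ^ 2) = 1 by ring, Real.sqrt_one]

/-- For `u` on the unit torus the matrix is unitary; the torus is a product of infinite sets, so the
relation extends to every `u`. The spectral theorem then covers all Hermitian matrices. -/
theorem commute_tensorPow_unitary_diagonal
    (h : ∀ U : Matrix.unitaryGroup I ℂ, tensorPow k U.1 * X = X * tensorPow k U.1)
    (V : Matrix.unitaryGroup I ℂ) (u : I → ℂ) :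
    tensorPow k (V.1 * Matrix.diagonal u * star V.1) * X =
      X * tensorPow k (V.1 * Matrix.diagonal u * star V.1) := by
  have hsum : ∀ u : I → ℂ, ∑ j, u j • (V.1 * Matrix.single j j 1 * star V.1) =
      V.1 * Matrix.diagonal u * star V.1 := by
    intro u
    rw [← Matrix.sum_single_eq_diagonal, Matrix.mul_sum, Matrix.sum_mul]
    refine Finset.sum_congr rfl fun j _ => ?_
    rw [← Matrix.smul_mul, ← Matrix.mul_smul, Matrix.smul_single, smul_eq_mul, mul_one]
  rw [← hsum]
  refine commute_tensorPow_of_infinite X _ (fun _ => {z : ℂ | ‖z‖ = 1})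
    (fun _ => infinite_unit_circle) (fun u hu => ?_) u
  rw [hsum]
  have hd : Matrix.diagonal u ∈ Matrix.unitaryGroup I ℂ := by
    rw [Matrix.mem_unitaryGroup_iff, Matrix.star_eq_conjTranspose, Matrix.diagonal_conjTranspose,
      Matrix.diagonal_mul_diagonal, ← Matrix.diagonal_one]
    congr 1
    ext j
    have hj : ‖u j‖ = 1 := hu j
    simp [Complex.mul_conj', hj]
  have hW : V.1 * Matrix.diagonal u * star V.1 ∈ Matrix.unitaryGroup I ℂ :=
    mul_mem (mul_mem V.2 hd) (star V).2
  exact h ⟨_, hW⟩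

theorem commute_tensorPow_hermitian
    (h : ∀ U : Matrix.unitaryGroup I ℂ, tensorPow k U.1 * X = X * tensorPow k U.1)
    {H : Matrix I I ℂ} (hH : H.IsHermitian) : tensorPow k H * X = X * tensorPow k H := by
  have hspec := hH.spectral_theorem
  rw [Unitary.conjStarAlgAut_apply] at hspec
  have key := commute_tensorPow_unitary_diagonal h hH.eigenvectorUnitary
    (RCLike.ofReal ∘ hH.eigenvalues)
  rw [hspec]
  exact key

/-- An operator commuting with `U^{⊗k}` for all unitaries `U` commutes with all tensor powers. -/
theorem commute_tensorPow
    (h : ∀ U : Matrix.unitaryGroup I ℂ, tensorPow k U.1 * X = X * tensorPow k U.1)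
    (M : Matrix I I ℂ) : tensorPow k M * X = X * tensorPow k M := by
  let B : Fin 2 → Matrix I I ℂ :=
    ![(realPart M : Matrix I I ℂ), (imaginaryPart M : Matrix I I ℂ)]
  -- Real combinations of the real and imaginary parts of `M` are Hermitian; extending to complex
  -- parameters reaches (1, i), that is, `M` itself.
  have key := commute_tensorPow_of_infinite X B (fun _ => Set.range ((↑) : ℝ → ℂ))
    (fun _ => Set.infinite_range_of_injective Complex.ofReal_injective) (fun u hu => by
      apply commute_tensorPow_hermitian h
      rw [Fin.sum_univ_two]
      obtain ⟨a, ha⟩ := hu 0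
      obtain ⟨b, hb⟩ := hu 1
      have hr : ((realPart M : Matrix I I ℂ)).conjTranspose = realPart M := (realPart M).2
      have hi : ((imaginaryPart M : Matrix I I ℂ)).conjTranspose = imaginaryPart M :=
        (imaginaryPart M).2
      simp [Matrix.IsHermitian, B, ← ha, ← hb, hr, hi]) ![1, Complex.I]
  have hM : ∑ j, (![1, Complex.I] : Fin 2 → ℂ) j • B j = M := by
    rw [Fin.sum_univ_two]
    simpa [B] using realPart_add_I_smul_imaginaryPart M
  rwa [hM] at key

/-- **Schur–Weyl duality** in the stable range: an operator commuting with all `U^{⊗k}` is a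
combination of permutation operators, with coefficients read off from a column indexed by an
injective tuple. -/
theorem eq_sum_perm_of_commute
    (h : ∀ U : Matrix.unitaryGroup I ℂ, tensorPow k U.1 * X = X * tensorPow k U.1)
    {x₀ : Fin k → I} (hx₀ : Function.Injective x₀) (x y : Fin k → I) :
    X x y = ∑ π : Equiv.Perm (Fin k), if x = y ∘ π then X (x₀ ∘ π) x₀ else 0 := by
  have hM := commute_tensorPow h
  -- Diagonal matrices compare torus weights: a nonzero entry in column `x₀` forces its row to have
  -- the same weight, hence to be a rearrangement of `x₀`.
  have hdiag : ∀ (u : I → ℂ) z, (∏ i, u (z i)) * X z x₀ = (∏ i, u (x₀ i)) * X z x₀ := by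
    intro u z
    have h1 := congrFun (congrFun (hM (Matrix.diagonal u)) z) x₀
    have hd : tensorPow k (Matrix.diagonal u) = Matrix.diagonal fun z => ∏ i, u (z i) := by
      ext a b
      simp only [tensorPow, Matrix.of_apply, Matrix.diagonal_apply, Finset.prod_ite_zero,
        Finset.mem_univ, forall_const, funext_iff]
    rw [hd, Matrix.diagonal_mul, Matrix.mul_diagonal] at h1
    rw [h1, mul_comm]
  have hsupp : ∀ z, X z x₀ ≠ 0 → ∃ π : Equiv.Perm (Fin k), z = x₀ ∘ π := by
    intro z hz
    have hu : ∀ u : I → ℂ, ∏ i, u (z i) = ∏ i, u (x₀ i) := fun u =>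
      mul_right_cancel₀ hz (hdiag u z)
    have hmem : ∀ i, ∃ j, x₀ j = z i := by
      intro i
      by_contra hcon
      have h1 := hu fun a => if a = z i then 0 else 1
      rw [Finset.prod_eq_zero (Finset.mem_univ i) (by simp), eq_comm, Finset.prod_eq_zero_iff] at h1
      obtain ⟨j, -, hj⟩ := h1
      exact hcon ⟨j, by simpa using hj⟩
    choose f hf using hmem
    have hsurj : Function.Surjective f := by
      intro j
      by_contra hcon
      have h1 := hu fun a => if a = x₀ j then 0 else 1
      rw [eq_comm, Finset.prod_eq_zero (Finset.mem_univ j) (by simp), eq_comm,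
        Finset.prod_eq_zero_iff] at h1
      obtain ⟨i, -, hi⟩ := h1
      exact hcon ⟨i, hx₀ (by rw [hf]; simpa using hi)⟩
    exact ⟨Equiv.ofBijective f (Finite.injective_iff_surjective.2 hsurj |>.bijective_of_finite), by
      ext i; simp [hf]⟩
  -- `M` sends the basis vector at `x₀ i` to the one at `y i`, which is consistent because `x₀` is
  -- injective. Its tensor power carries column `x₀` of `X` to column `y`.
  let M : Matrix I I ℂ := Matrix.of fun a b => ∑ i, if b = x₀ i ∧ a = y i then 1 else 0
  have hMx : ∀ a i, M a (x₀ i) = if a = y i then 1 else 0 := by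
    intro a i
    simp only [M, Matrix.of_apply, hx₀.eq_iff, ite_and]
    simp
  have h1 := congrFun (congrFun (hM M) x) x₀
  rw [Matrix.mul_apply, Matrix.mul_apply] at h1
  have hR : ∑ z, X x z * tensorPow k M z x₀ = X x y := by
    have : ∀ z, tensorPow k M z x₀ = if z = y then 1 else 0 := by
      intro z
      simp only [tensorPow, Matrix.of_apply, hMx, Finset.prod_ite_zero, Finset.mem_univ,
        forall_const, Finset.prod_const_one, funext_iff]
    simp [this]
  rw [hR] at h1
  rw [← h1]
  have hinj : Function.Injective fun π : Equiv.Perm (Fin k) => x₀ ∘ π := by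
    intro π π' hp
    ext i
    exact congrArg _ (hx₀ (congrFun hp i))
  have hsub : ∑ z, tensorPow k M x z * X z x₀ =
      ∑ z ∈ Finset.univ.image fun π : Equiv.Perm (Fin k) => x₀ ∘ π,
        tensorPow k M x z * X z x₀ := by
    symm
    refine Finset.sum_subset (Finset.subset_univ _) fun z _ hz => ?_
    by_contra hne
    obtain ⟨π, rfl⟩ := hsupp z (right_ne_zero_of_mul hne)
    exact hz (Finset.mem_image_of_mem _ (Finset.mem_univ π))
  rw [hsub, Finset.sum_image hinj.injOn]
  refine Finset.sum_congr rfl fun π _ => ?_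
  have : tensorPow k M x (x₀ ∘ π) = if x = y ∘ π then 1 else 0 := by
    simp only [tensorPow, Matrix.of_apply, Function.comp_apply, hMx, Finset.prod_ite_zero,
      Finset.mem_univ, forall_const, Finset.prod_const_one, funext_iff]
  rw [this, ite_mul, one_mul, zero_mul]

/-- The permutation operators are nearly orthogonal: restricting to injective columns bounds the
coefficients of a combination of permutation operators. -/
theorem descFactorial_mul_le_sum_perm (c : Equiv.Perm (Fin k) → ℂ) :
    ((Fintype.card I).descFactorial k : ℝ) * ∑ π, ‖c π‖ ^ 2 ≤
      ∑ y : Fin k → I, ∑ x : Fin k → I, ‖∑ π : Equiv.Perm (Fin k), if x = y ∘ π then c π else 0‖ ^ 2 := by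
  have hcard : Fintype.card {y : Fin k → I // Function.Injective y} =
      (Fintype.card I).descFactorial k := by
    rw [Fintype.card_congr (Equiv.subtypeInjectiveEquivEmbedding (Fin k) I),
      Fintype.card_embedding_eq, Fintype.card_fin]
  -- In an injective column the rows `y ∘ π` are distinct, so no two coefficients interfere.
  have hle : ∀ y : Fin k → I, Function.Injective y →
      ∑ π, ‖c π‖ ^ 2 ≤ ∑ x : Fin k → I, ‖∑ π : Equiv.Perm (Fin k), if x = y ∘ π then c π else 0‖ ^ 2 := by
    intro y hy
    have hinj : Function.Injective fun π : Equiv.Perm (Fin k) => y ∘ π := by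
      intro π π' hp
      ext i
      exact congrArg _ (hy (congrFun hp i))
    calc ∑ π, ‖c π‖ ^ 2
        = ∑ π' : Equiv.Perm (Fin k),
            ‖∑ π : Equiv.Perm (Fin k), if y ∘ π' = y ∘ π then c π else 0‖ ^ 2 := by
          refine Finset.sum_congr rfl fun π' _ => ?_
          have : ∀ π : Equiv.Perm (Fin k), y ∘ π' = y ∘ π ↔ π' = π := fun π => hinj.eq_iff
          simp [this]
      _ = ∑ x ∈ Finset.univ.image fun π : Equiv.Perm (Fin k) => y ∘ π,
            ‖∑ π : Equiv.Perm (Fin k), if x = y ∘ π then c π else 0‖ ^ 2 :=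
          (Finset.sum_image (f := fun x =>
            ‖∑ π : Equiv.Perm (Fin k), if x = y ∘ π then c π else 0‖ ^ 2) hinj.injOn).symm
      _ ≤ _ := Finset.sum_le_sum_of_subset_of_nonneg (Finset.subset_univ _) fun _ _ _ => by
          positivity
  classical
  calc ((Fintype.card I).descFactorial k : ℝ) * ∑ π, ‖c π‖ ^ 2
      = ∑ y ∈ Finset.univ.filter fun y : Fin k → I => Function.Injective y, ∑ π, ‖c π‖ ^ 2 := by
        rw [Finset.sum_const, nsmul_eq_mul, ← hcard, Fintype.card_subtype]
    _ ≤ ∑ y ∈ Finset.univ.filter fun y : Fin k → I => Function.Injective y,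
          ∑ x : Fin k → I, ‖∑ π : Equiv.Perm (Fin k), if x = y ∘ π then c π else 0‖ ^ 2 :=
        Finset.sum_le_sum fun y hy => hle y (Finset.mem_filter.1 hy).2
    _ ≤ _ := Finset.sum_le_sum_of_subset_of_nonneg (Finset.subset_univ _) fun _ _ _ => by
        positivity

end SchurWeyl

/-! ### Gram matrices of permutation operators and factorial estimates. -/

section Counting

variable {k : ℕ}

/-- The Hilbert–Schmidt inner product of the permutation operators of `σ` and `τ` on
`(ℂ^ι)^{⊗k}`: the number of tuples on which `σ` and `τ` act in the same way. -/
def agreeCount (ι : Type*) [Fintype ι] [DecidableEq ι] (σ τ : Equiv.Perm (Fin k)) : ℕ :=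
  Fintype.card {z : Fin k → ι // z ∘ σ = z ∘ τ}

theorem agreeCount_congr {ι κ : Type*} [Fintype ι] [DecidableEq ι] [Fintype κ] [DecidableEq κ]
    (e : ι ≃ κ) (σ τ : Equiv.Perm (Fin k)) : agreeCount ι σ τ = agreeCount κ σ τ :=
  Fintype.card_congr ((Equiv.arrowCongr (Equiv.refl _) e).subtypeEquiv fun z => by
    simp [funext_iff])

theorem card_agree_pi {T : Type*} [Fintype T] [DecidableEq T] {q : ℕ}
    (p p' : T → Equiv.Perm (Fin k)) :
    Fintype.card {y : Fin k → T → Fin q // ∀ s i, y (p s i) s = y (p' s i) s} =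
      ∏ s, agreeCount (Fin q) (p s) (p' s) := by
  simp only [agreeCount]
  rw [← Fintype.card_pi]
  refine Fintype.card_congr ?_
  refine ((Equiv.piComm fun (_ : Fin k) (_ : T) => Fin q).subtypeEquiv
    (q := fun y : T → Fin k → Fin q => ∀ s, y s ∘ p s = y s ∘ p' s) fun y => ?_).trans
    (Equiv.subtypePiEquivPi (p := fun s (z : Fin k → Fin q) => z ∘ p s = z ∘ p' s))
  simp [funext_iff, Equiv.piComm]

theorem agreeCount_pi (T : Type*) [Fintype T] [DecidableEq T] (q : ℕ) (σ τ : Equiv.Perm (Fin k)) :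
    agreeCount (T → Fin q) σ τ = agreeCount (Fin q) σ τ ^ Fintype.card T := by
  have h := card_agree_pi (q := q) (fun _ : T => σ) (fun _ => τ)
  rw [Finset.prod_const, Finset.card_univ] at h
  rw [← h, agreeCount]
  refine Fintype.card_congr (Equiv.subtypeEquivRight fun z => ?_)
  simp only [funext_iff, Function.comp_apply]
  exact forall_comm

theorem agreeCount_fin_pow (q j : ℕ) (σ τ : Equiv.Perm (Fin k)) :
    agreeCount (Fin (q ^ j)) σ τ = agreeCount (Fin q) σ τ ^ j := by
  rw [agreeCount_congr (Fintype.equivOfCardEq (by simp) : Fin (q ^ j) ≃ (Fin j → Fin q)),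
    agreeCount_pi, Fintype.card_fin]

theorem agreeCount_comm {ι : Type*} [Fintype ι] [DecidableEq ι] (σ τ : Equiv.Perm (Fin k)) :
    agreeCount ι σ τ = agreeCount ι τ σ :=
  Fintype.card_congr (Equiv.subtypeEquivRight fun _ => eq_comm)

theorem agreeCount_self {ι : Type*} [Fintype ι] [DecidableEq ι] (σ : Equiv.Perm (Fin k)) :
    agreeCount ι σ σ = Fintype.card ι ^ k := by
  simp [agreeCount]

theorem agreeCount_eq_one_left {ι : Type*} [Fintype ι] [DecidableEq ι]
    (σ τ : Equiv.Perm (Fin k)) : agreeCount ι σ τ = agreeCount ι 1 (τ * σ⁻¹) := by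
  refine Fintype.card_congr (Equiv.subtypeEquivRight fun z => ?_)
  simp only [funext_iff, Function.comp_apply, Equiv.Perm.coe_mul, Equiv.Perm.coe_one, id]
  constructor
  · intro h i
    simpa using h (σ⁻¹ i)
  · intro h i
    simpa using h (σ i)

/-- The orbits of tuples under permutations of positions are the multisets. -/
def tupleOrbitEquivSym (n k : ℕ) :
    Quotient (MulAction.orbitRel (Equiv.Perm (Fin k))ᵈᵐᵃ (Fin k → Fin n)) ≃ Sym (Fin n) k :=
  Equiv.ofBijective
    (Quotient.lift (fun z => (⟨(List.ofFn z : Multiset (Fin n)), by simp⟩ : Sym (Fin n) k)) (by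
      rintro z z' ⟨g, rfl⟩
      exact Subtype.ext (Multiset.coe_eq_coe.2 ((DomMulAct.mk.symm g).ofFn_comp_perm z'))))
    ⟨by
      rintro ⟨z⟩ ⟨z'⟩ h
      have h1 : (List.ofFn z).Perm (List.ofFn z') := Multiset.coe_eq_coe.1 (congrArg Subtype.val h)
      -- Tuples with the same multiset of entries have the same sorted form.
      have h2 : z ∘ Tuple.sort z = z' ∘ Tuple.sort z' :=
        List.ofFn_injective ((((Tuple.sort z).ofFn_comp_perm z).trans
          (h1.trans ((Tuple.sort z').ofFn_comp_perm z').symm)).eq_of_pairwise'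
          (Tuple.monotone_sort z).sortedLE_ofFn.pairwise
          (Tuple.monotone_sort z').sortedLE_ofFn.pairwise)
      refine Quotient.sound ⟨DomMulAct.mk (Tuple.sort z' * (Tuple.sort z)⁻¹), ?_⟩
      ext i
      have := congrFun h2 ((Tuple.sort z).symm i)
      simp only [Function.comp_apply, Equiv.apply_symm_apply] at this
      simp [DomMulAct.smul_apply, ← this], by
      rintro ⟨s, hs⟩
      induction s using Quotient.inductionOn with
      | h l =>
        have hl : l.length = k := hs
        subst hl
        exact ⟨Quotient.mk _ l.get, Subtype.ext (by
          change ((List.ofFn l.get : List (Fin n)) : Multiset (Fin n)) = _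
          rw [List.ofFn_get]; rfl)⟩⟩

/-- Translating `σ` to the identity turns the summands into fixed-point counts on tuples. Burnside's
lemma gives `k!` times the number of orbits, and the orbits are multisets. -/
theorem sum_agreeCount_fin (n : ℕ) (σ : Equiv.Perm (Fin k)) :
    ∑ τ, agreeCount (Fin n) σ τ = k.factorial * (n + k - 1).choose k := by
  classical
  have h1 : ∑ τ, agreeCount (Fin n) σ τ = ∑ π, agreeCount (Fin n) (1 : Equiv.Perm (Fin k)) π :=
    Fintype.sum_equiv (Equiv.mulRight σ⁻¹) _ _ fun τ => agreeCount_eq_one_left σ τ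
  let _ : Fintype (Equiv.Perm (Fin k))ᵈᵐᵃ := Fintype.ofEquiv _ DomMulAct.mk
  have h2 := MulAction.sum_card_fixedBy_eq_card_orbits_mul_card_group
    (Equiv.Perm (Fin k))ᵈᵐᵃ (Fin k → Fin n)
  rw [Fintype.card_congr (tupleOrbitEquivSym n k), Sym.card_sym_eq_choose, Fintype.card_fin,
    ← Fintype.card_congr (DomMulAct.mk (M := Equiv.Perm (Fin k))), Fintype.card_perm,
    Fintype.card_fin] at h2
  rw [h1, mul_comm, ← h2]
  refine Fintype.sum_equiv DomMulAct.mk _ _ fun π => ?_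
  refine Fintype.card_congr (Equiv.subtypeEquivRight fun z => ?_)
  rw [MulAction.mem_fixedBy, eq_comm]
  rfl

theorem sum_agreeCount {ι : Type*} [Fintype ι] [DecidableEq ι] (σ : Equiv.Perm (Fin k)) :
    ∑ τ, agreeCount ι σ τ = k.factorial * (Fintype.card ι + k - 1).choose k := by
  rw [← sum_agreeCount_fin _ σ]
  exact Finset.sum_congr rfl fun τ _ => agreeCount_congr (Fintype.equivFin ι) σ τ

/-- The right-hand side is the sum over all τ' of the left-hand kind of sum with τ' in place of `τ`.
Since `σ ≠ τ`, the summand τ' = σ is separate from τ' = τ, and its term π = σ alone is the square of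
`card ι ^ k`. -/
theorem sum_agreeCount_mul_agreeCount_le {ι : Type*} [Fintype ι] [DecidableEq ι]
    {σ τ : Equiv.Perm (Fin k)} (h : σ ≠ τ) :
    ∑ π, agreeCount ι π σ * agreeCount ι π τ + (Fintype.card ι ^ k) ^ 2 ≤
      (k.factorial * (Fintype.card ι + k - 1).choose k) ^ 2 := by
  have htot : (k.factorial * (Fintype.card ι + k - 1).choose k) ^ 2 =
      ∑ τ', ∑ π, agreeCount ι π σ * agreeCount ι π τ' := by
    rw [Finset.sum_comm]
    simp only [← Finset.mul_sum, sum_agreeCount]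
    rw [← Finset.sum_mul]
    simp only [agreeCount_comm _ σ, sum_agreeCount]
    rw [sq]
  rw [htot]
  have hsub : ∑ τ' ∈ {τ, σ}, ∑ π, agreeCount ι π σ * agreeCount ι π τ' ≤
      ∑ τ', ∑ π, agreeCount ι π σ * agreeCount ι π τ' :=
    Finset.sum_le_sum_of_subset (Finset.subset_univ _)
  rw [Finset.sum_pair h.symm] at hsub
  refine le_trans (Nat.add_le_add_left ?_ _) hsub
  refine le_trans (le_of_eq ?_) (Finset.single_le_sum (fun _ _ => Nat.zero_le _)
    (Finset.mem_univ σ))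
  rw [agreeCount_self, sq]

/-- Schur test for a sum of partial isometries between basis vectors. -/
theorem sum_norm_sq_le_of_agree {C R : Type*} [Fintype C] [Fintype R] [DecidableEq R]
    (f : C → R → R) (v : C → ℂ) (B : ℝ)
    (hB : ∀ c, ∑ c', (Fintype.card {s // f c s = f c' s} : ℝ) ≤ B) :
    ∑ s, ∑ r, ‖∑ c, if r = f c s then v c else 0‖ ^ 2 ≤ B * ∑ c, ‖v c‖ ^ 2 := by
  -- Expanding the square leaves the pairs with `f c s = f c' s`; AM–GM splits each product.
  have hpt : ∀ s, ∑ r, ‖∑ c, if r = f c s then v c else 0‖ ^ 2 ≤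
      ∑ c, ∑ c', if f c s = f c' s then (‖v c‖ ^ 2 + ‖v c'‖ ^ 2) / 2 else 0 := by
    intro s
    calc ∑ r, ‖∑ c, if r = f c s then v c else 0‖ ^ 2
        ≤ ∑ r, ∑ c, ∑ c', if r = f c s then (if r = f c' s then ‖v c‖ * ‖v c'‖ else 0) else 0 := by
          refine Finset.sum_le_sum fun r _ => ?_
          refine (pow_le_pow_left₀ (norm_nonneg _) (norm_sum_le _ _) 2).trans (le_of_eq ?_)
          rw [sq, Finset.sum_mul_sum]
          refine Finset.sum_congr rfl fun c _ => Finset.sum_congr rfl fun c' _ => ?_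
          split_ifs <;> simp
      _ = ∑ c, ∑ c', if f c s = f c' s then ‖v c‖ * ‖v c'‖ else 0 := by
          rw [Finset.sum_comm]
          refine Finset.sum_congr rfl fun c _ => ?_
          rw [Finset.sum_comm]
          refine Finset.sum_congr rfl fun c' _ => ?_
          simp
      _ ≤ _ := by
          refine Finset.sum_le_sum fun c _ => Finset.sum_le_sum fun c' _ => ?_
          split_ifs
          · nlinarith [sq_nonneg (‖v c‖ - ‖v c'‖)]
          · exact le_rfl
  have hcard : ∀ c c', (∑ s, if f c s = f c' s then (1 : ℝ) else 0) =
      Fintype.card {s // f c s = f c' s} := by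
    intro c c'
    rw [Finset.sum_boole, Fintype.card_subtype]
  have hsymm : ∀ c c', (Fintype.card {s // f c s = f c' s} : ℝ) =
      Fintype.card {s // f c' s = f c s} := fun c c' => by
    rw [Fintype.card_congr (Equiv.subtypeEquivRight fun _ => eq_comm)]
  calc _ ≤ ∑ s, ∑ c, ∑ c', if f c s = f c' s then (‖v c‖ ^ 2 + ‖v c'‖ ^ 2) / 2 else 0 :=
        Finset.sum_le_sum fun s _ => hpt s
    _ = ∑ c, ∑ c', (Fintype.card {s // f c s = f c' s} : ℝ) * ((‖v c‖ ^ 2 + ‖v c'‖ ^ 2) / 2) := by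
        rw [Finset.sum_comm]
        refine Finset.sum_congr rfl fun c _ => ?_
        rw [Finset.sum_comm]
        refine Finset.sum_congr rfl fun c' _ => ?_
        rw [← hcard, Finset.sum_mul]
        simp
    _ = ∑ c, (∑ c', (Fintype.card {s // f c s = f c' s} : ℝ)) * ‖v c‖ ^ 2 := by
        have e1 : ∑ c, ∑ c', (Fintype.card {s // f c s = f c' s} : ℝ) * ‖v c'‖ ^ 2 =
            ∑ c, ∑ c', (Fintype.card {s // f c s = f c' s} : ℝ) * ‖v c‖ ^ 2 := by
          rw [Finset.sum_comm]
          exact Finset.sum_congr rfl fun c _ => Finset.sum_congr rfl fun c' _ => by rw [hsymm]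
        have e2 : ∀ c c', (Fintype.card {s // f c s = f c' s} : ℝ) *
            ((‖v c‖ ^ 2 + ‖v c'‖ ^ 2) / 2) =
            ((Fintype.card {s // f c s = f c' s} : ℝ) * ‖v c‖ ^ 2 +
            (Fintype.card {s // f c s = f c' s} : ℝ) * ‖v c'‖ ^ 2) / 2 := fun c c' => by ring
        simp only [e2, ← Finset.sum_div, Finset.sum_add_distrib, e1, Finset.sum_mul]
        ring
    _ ≤ ∑ c, B * ‖v c‖ ^ 2 :=
        Finset.sum_le_sum fun c _ => mul_le_mul_of_nonneg_right (hB c) (by positivity)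
    _ = _ := by rw [Finset.mul_sum]

theorem factorial_mul_choose_eq_ascFactorial {n : ℕ} (k : ℕ) :
    k.factorial * (n + k - 1).choose k = n.ascFactorial k :=
  (Nat.ascFactorial_eq_factorial_mul_choose' n k).symm

theorem pow_mul_one_sub_le_descFactorial {n k : ℕ} (hn : 0 < n) (hk : k ≤ n) :
    (n : ℝ) ^ k * (1 - (k : ℝ) ^ 2 / (2 * n)) ≤ n.descFactorial k := by
  have hn' : (0 : ℝ) < n := by exact_mod_cast hn
  -- The induction closes with `k (k - 1)`, the sum of the deficits in the factors 1 - i/n; with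
  -- `k²` it would not be tight enough.
  suffices h : (n : ℝ) ^ k * (1 - (k : ℝ) * (k - 1) / (2 * n)) ≤ n.descFactorial k by
    refine le_trans (mul_le_mul_of_nonneg_left ?_ (by positivity)) h
    have hk0 : (0 : ℝ) ≤ k := Nat.cast_nonneg k
    gcongr
    nlinarith
  induction k with
  | zero => simp
  | succ k ih =>
    have hkn : (k : ℝ) + 1 ≤ n := by exact_mod_cast hk
    have hk0 : (0 : ℝ) ≤ k := Nat.cast_nonneg k
    rw [Nat.descFactorial_succ, Nat.cast_mul, Nat.cast_sub (by omega)]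
    refine le_trans ?_ (mul_le_mul_of_nonneg_left (ih (by omega)) (by linarith))
    rw [pow_succ, mul_comm ((n : ℝ) - k), mul_assoc, mul_assoc]
    refine mul_le_mul_of_nonneg_left ?_ (by positivity)
    push_cast
    have e : (1 - (k : ℝ) * (k - 1) / (2 * n)) * (n - k) - n * (1 - (k + 1) * (k + 1 - 1) / (2 * n))
        = k * (k * (k - 1)) / (2 * n) := by
      field_simp
      ring
    have : 0 ≤ (k : ℝ) * (k * (k - 1)) / (2 * n) := by
      rcases Nat.eq_zero_or_pos k with rfl | hp
      · simp
      · have : (1 : ℝ) ≤ k := by exact_mod_cast hp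
        have : 0 ≤ (k : ℝ) - 1 := by linarith
        positivity
    linarith

theorem ascFactorial_le_pow_mul_exp {n : ℕ} (hn : 0 < n) (k : ℕ) :
    (n.ascFactorial k : ℝ) ≤ (n : ℝ) ^ k * Real.exp ((k : ℝ) ^ 2 / (2 * n)) := by
  have hn' : (0 : ℝ) < n := by exact_mod_cast hn
  induction k with
  | zero => simp
  | succ k ih =>
    rw [Nat.ascFactorial_succ, Nat.cast_mul]
    -- Each factor 1 + k/n is at most exp(k/n), and k/n + k²/(2n) ≤ (k+1)²/(2n).
    have h1 : ((n + k : ℕ) : ℝ) ≤ n * Real.exp (k / n) := by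
      have := Real.add_one_le_exp ((k : ℝ) / n)
      calc ((n + k : ℕ) : ℝ) = n * (k / n + 1) := by push_cast; field_simp; ring
        _ ≤ _ := by gcongr
    calc ((n + k : ℕ) : ℝ) * n.ascFactorial k
        ≤ (n * Real.exp (k / n)) * ((n : ℝ) ^ k * Real.exp ((k : ℝ) ^ 2 / (2 * n))) := by gcongr
      _ = (n : ℝ) ^ (k + 1) * Real.exp (k / n + (k : ℝ) ^ 2 / (2 * n)) := by
          rw [Real.exp_add]; ring
      _ ≤ _ := by
          gcongr
          push_cast
          rw [div_add_div _ _ hn'.ne' (by positivity), div_le_div_iff₀ (by positivity) (by positivity)]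
          nlinarith [mul_pos hn' (mul_pos hn' hn')]

/-- The normalized rising factorials decrease in the base. -/
theorem ascFactorial_sq_div_le {n : ℕ} (hn : 0 < n) (k : ℕ) :
    ((n ^ 2).ascFactorial k : ℝ) / ((n : ℝ) ^ 2) ^ k ≤ n.ascFactorial k / (n : ℝ) ^ k := by
  have hn' : (1 : ℝ) ≤ n := by exact_mod_cast hn
  induction k with
  | zero => simp
  | succ k ih =>
    rw [Nat.ascFactorial_succ, Nat.ascFactorial_succ, Nat.cast_mul, Nat.cast_mul, pow_succ _ k,
      pow_succ _ k, mul_comm (((n : ℝ) ^ 2) ^ k), mul_comm ((n : ℝ) ^ k), mul_div_mul_comm,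
      mul_div_mul_comm]
    refine mul_le_mul ?_ ih (by positivity) (by positivity)
    push_cast
    rw [div_le_div_iff₀ (by positivity) (by positivity)]
    nlinarith [mul_nonneg (mul_nonneg (Nat.cast_nonneg (α := ℝ) k) (by linarith : (0:ℝ) ≤ n)) (sub_nonneg.2 hn')]

end Counting

/-! ### Block decomposition along a set of sites. -/

section Blocks

variable {σ : Type*} [DecidableEq σ] {q k : ℕ}

/-- Tuples of configurations on `S` and on its complement glue to tuples of configurations. -/
def glueEquiv (S : Finset σ) (q k : ℕ) :
    (Fin k → {s // s ∈ S} → Fin q) × (Fin k → {s // s ∉ S} → Fin q) ≃ (Fin k → σ → Fin q) :=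
  (Equiv.arrowProdEquivProdArrow _ _ _).symm.trans
    (Equiv.arrowCongr (Equiv.refl _) (Equiv.piEquivPiSubtypeProd (· ∈ S) fun _ => Fin q).symm)

/-- The tuple equal to `y` on `S` and to `r` off `S`. -/
def glue (S : Finset σ) (y : Fin k → {s // s ∈ S} → Fin q) (r : Fin k → {s // s ∉ S} → Fin q) :
    Fin k → σ → Fin q :=
  glueEquiv S q k (y, r)

theorem glue_split (S : Finset σ) (y : Fin k → {s // s ∈ S} → Fin q)
    (r : Fin k → {s // s ∉ S} → Fin q) (i : Fin k) :
    Equiv.piEquivPiSubtypeProd (· ∈ S) (fun _ => Fin q) (glue S y r i) = (y i, r i) := by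
  simp [glue, glueEquiv, Equiv.arrowProdEquivProdArrow]

theorem glue_mem (S : Finset σ) (y : Fin k → {s // s ∈ S} → Fin q)
    (r : Fin k → {s // s ∉ S} → Fin q) (i : Fin k) (s : {s // s ∈ S}) :
    glue S y r i s = y i s :=
  congrFun (congrArg Prod.fst (glue_split S y r i)) s

theorem glue_not_mem (S : Finset σ) (y : Fin k → {s // s ∈ S} → Fin q)
    (r : Fin k → {s // s ∉ S} → Fin q) (i : Fin k) (s : {s // s ∉ S}) :
    glue S y r i s = r i s :=
  congrFun (congrArg Prod.snd (glue_split S y r i)) s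

theorem exists_glue (S : Finset σ) (x : Fin k → σ → Fin q) : ∃ y r, x = glue S y r :=
  ⟨((glueEquiv S q k).symm x).1, ((glueEquiv S q k).symm x).2, by simp [glue]⟩

theorem exists_injective_tuple {S : Finset σ} (hk : k ≤ q ^ S.card) :
    ∃ x₀ : Fin k → {s // s ∈ S} → Fin q, Function.Injective x₀ := by
  have hcard : Fintype.card (Fin k) ≤ Fintype.card ({s // s ∈ S} → Fin q) := by simpa using hk
  obtain ⟨f⟩ := Function.Embedding.nonempty_of_card_le hcard
  exact ⟨f, f.injective⟩

variable [Fintype σ]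

theorem sum_glue {M : Type*} [AddCommMonoid M] (S : Finset σ) (f : (Fin k → σ → Fin q) → M) :
    ∑ x, f x = ∑ r, ∑ y, f (glue S y r) := by
  rw [← (glueEquiv S q k).sum_comp, Fintype.sum_prod_type, Finset.sum_comm]
  rfl

theorem siteRep_glue (S : Finset σ)
    (U : Matrix ({s // s ∈ S} → Fin q) ({s // s ∈ S} → Fin q) ℂ)
    (y z : Fin k → {s // s ∈ S} → Fin q) (r s : Fin k → {s // s ∉ S} → Fin q) :
    siteRep S k U (glue S y r) (glue S z s) = tensorPow k U y z * if r = s then 1 else 0 := by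
  simp only [siteRep, tensorPow, embed, Matrix.of_apply, Matrix.submatrix_apply, glue_split,
    Matrix.kroneckerMap_apply, Matrix.one_apply, Finset.prod_mul_distrib, Finset.prod_ite_zero,
    Finset.mem_univ, forall_const, Finset.prod_const_one, funext_iff (f := r)]

theorem siteRep_compl_glue {S T : Finset σ} (hST : ∀ s, s ∉ S ↔ s ∈ T)
    (V : Matrix ({s // s ∈ T} → Fin q) ({s // s ∈ T} → Fin q) ℂ)
    (y z : Fin k → {s // s ∈ S} → Fin q) (r s : Fin k → {s // s ∉ S} → Fin q) :
    siteRep T k V (glue S y r) (glue S z s) = (if y = z then 1 else 0) *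
      tensorPow k (V.submatrix (complEquiv S T hST q) (complEquiv S T hST q)) r s := by
  simp only [siteRep, tensorPow, embed_eq_one_kronecker hST, Matrix.of_apply,
    Matrix.submatrix_apply, glue_split,
    Matrix.kroneckerMap_apply, Matrix.one_apply, Finset.prod_mul_distrib, Finset.prod_ite_zero,
    Finset.mem_univ, forall_const, Finset.prod_const_one, funext_iff (f := y)]

/-- The block of `X` with fixed row and column configurations off `S`. -/
def block (S : Finset σ) (X : Op σ q k) (r s : Fin k → {s // s ∉ S} → Fin q) :
    Matrix (Fin k → {s // s ∈ S} → Fin q) (Fin k → {s // s ∈ S} → Fin q) ℂ :=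
  Matrix.of fun y z => X (glue S y r) (glue S z s)

theorem IsTwirlInvariant.commute_block {S : Finset σ} {X : Op σ q k} (h : IsTwirlInvariant S X)
    (r s : Fin k → {s // s ∉ S} → Fin q)
    (U : Matrix.unitaryGroup ({s // s ∈ S} → Fin q) ℂ) :
    tensorPow k U.1 * block S X r s = block S X r s * tensorPow k U.1 := by
  ext y z
  have h1 := congrFun (congrFun (h U) (glue S y r)) (glue S z s)
  rw [Matrix.mul_apply, Matrix.mul_apply, sum_glue S, sum_glue S] at h1
  simpa [siteRep_glue, Matrix.mul_apply, block] using h1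

/-- The coefficient of the permutation operator of `π` in the blocks of an invariant operator. -/
def blockCoeff (S : Finset σ) (X : Op σ q k) (x₀ : Fin k → {s // s ∈ S} → Fin q)
    (π : Equiv.Perm (Fin k)) :
    Matrix (Fin k → {s // s ∉ S} → Fin q) (Fin k → {s // s ∉ S} → Fin q) ℂ :=
  Matrix.of fun r s => X (glue S (x₀ ∘ π) r) (glue S x₀ s)

theorem IsTwirlInvariant.apply_glue {S : Finset σ} {X : Op σ q k} (h : IsTwirlInvariant S X)
    {x₀ : Fin k → {s // s ∈ S} → Fin q} (hx₀ : Function.Injective x₀)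
    (y z : Fin k → {s // s ∈ S} → Fin q) (r s : Fin k → {s // s ∉ S} → Fin q) :
    X (glue S y r) (glue S z s) =
      ∑ π : Equiv.Perm (Fin k), if y = z ∘ π then blockCoeff S X x₀ π r s else 0 :=
  eq_sum_perm_of_commute (h.commute_block r s) hx₀ y z

theorem hsSq_glue (S : Finset σ) (X : Op σ q k) :
    hsSq X = ∑ s, ∑ r, ∑ z, ∑ y, ‖X (glue S y r) (glue S z s)‖ ^ 2 := by
  rw [hsSq, sum_glue S]
  refine Finset.sum_congr rfl fun s _ => ?_
  rw [Finset.sum_comm, sum_glue S]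
  refine Finset.sum_congr rfl fun r _ => ?_
  rw [Finset.sum_comm]

theorem hsInner_glue (S : Finset σ) (X Y : Op σ q k) :
    hsInner X Y = ∑ s, ∑ r, ∑ z, ∑ y,
      star (X (glue S y r) (glue S z s)) * Y (glue S y r) (glue S z s) := by
  rw [hsInner_eq_sum, sum_glue S]
  refine Finset.sum_congr rfl fun s _ => ?_
  rw [Finset.sum_comm, sum_glue S]
  refine Finset.sum_congr rfl fun r _ => ?_
  rw [Finset.sum_comm]

/-- Each block is a combination of permutation operators on `S`, so near-orthogonality applies block
by block. -/
theorem IsTwirlInvariant.descFactorial_mul_sum_le {S : Finset σ} {X : Op σ q k}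
    (h : IsTwirlInvariant S X)
    {x₀ : Fin k → {s // s ∈ S} → Fin q} (hx₀ : Function.Injective x₀) :
    ((q ^ S.card).descFactorial k : ℝ) * ∑ π, hsSq (blockCoeff S X x₀ π) ≤ hsSq X := by
  have hcard : Fintype.card ({s // s ∈ S} → Fin q) = q ^ S.card := by simp
  simp only [hsSq]
  rw [Finset.sum_comm, Finset.mul_sum, ← hsSq, hsSq_glue S]
  refine Finset.sum_le_sum fun s _ => ?_
  rw [Finset.sum_comm, Finset.mul_sum]
  refine Finset.sum_le_sum fun r _ => ?_
  rw [← hcard]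
  refine (descFactorial_mul_le_sum_perm _).trans (le_of_eq ?_)
  simp only [h.apply_glue hx₀]

/-- A twirl is controlled by the partial overlaps with the permutation operators on `S`. -/
theorem descFactorial_mul_hsSq_twirl_le {S : Finset σ} (hk : k ≤ q ^ S.card) (Y : Op σ q k) :
    ((q ^ S.card).descFactorial k : ℝ) * hsSq (twirl S q k Y) ≤
      ∑ π : Equiv.Perm (Fin k), ∑ s, ∑ r,
        ‖∑ z : Fin k → {s // s ∈ S} → Fin q, Y (glue S (z ∘ π) r) (glue S z s)‖ ^ 2 := by
  obtain ⟨x₀, hx₀⟩ := exists_injective_tuple hk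
  set Z := twirl S q k Y with hZ
  have hinv : IsTwirlInvariant S Z := isTwirlInvariant_twirl S Y
  set t : Equiv.Perm (Fin k) → (Fin k → {s // s ∉ S} → Fin q) →
      (Fin k → {s // s ∉ S} → Fin q) → ℂ :=
    fun π s r => ∑ z : Fin k → {s // s ∈ S} → Fin q, Y (glue S (z ∘ π) r) (glue S z s) with ht
  -- As `Z` is the twirl of `Y`, ⟨Z, Z⟩ = ⟨Z, Y⟩; expanding only the left factor in permutation
  -- operators produces the partial overlaps `t`.
  have hZZ : (hsSq Z : ℂ) = ∑ π, ∑ s, ∑ r, star (blockCoeff S Z x₀ π r s) * t π s r := by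
    rw [← hsInner_self, hsInner_twirl hinv, hsInner_glue S]
    rw [Finset.sum_comm (s := Finset.univ (α := Equiv.Perm (Fin k)))]
    refine Finset.sum_congr rfl fun s _ => ?_
    rw [Finset.sum_comm (s := Finset.univ (α := Equiv.Perm (Fin k)))]
    refine Finset.sum_congr rfl fun r _ => ?_
    simp only [hinv.apply_glue hx₀, star_sum, Finset.sum_mul, ht, Finset.mul_sum]
    rw [Finset.sum_comm (s := Finset.univ (α := Equiv.Perm (Fin k)))]
    refine Finset.sum_congr rfl fun z _ => ?_
    rw [Finset.sum_comm]
    refine Finset.sum_congr rfl fun π _ => ?_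
    rw [Finset.sum_eq_single (z ∘ π)]
    · simp
    · intro y _ hy
      simp [hy]
    · simp
  have hcs : hsSq Z ^ 2 ≤ (∑ π, hsSq (blockCoeff S Z x₀ π)) * ∑ π, ∑ s, ∑ r, ‖t π s r‖ ^ 2 := by
    have h1 : hsSq Z = ‖(hsSq Z : ℂ)‖ := by
      rw [Complex.norm_real, Real.norm_of_nonneg (hsSq_nonneg _)]
    rw [h1, hZZ]
    simp only [hsSq, ← Finset.sum_product', Finset.univ_product_univ]
    refine (pow_le_pow_left₀ (norm_nonneg _) (norm_sum_le _ _) 2).trans ?_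
    simp only [norm_mul, norm_star]
    exact Finset.sum_mul_sq_le_sq_mul_sq _ _ _
  have hlow := hinv.descFactorial_mul_sum_le hx₀
  have hT : 0 ≤ ∑ π, ∑ s, ∑ r, ‖t π s r‖ ^ 2 := by positivity
  -- With N = ‖Z‖², C the coefficient sum, F the falling factorial and O the overlap sum, N² ≤ CO
  -- and FC ≤ N give FN² ≤ NO; then divide by N.
  rcases (hsSq_nonneg Z).eq_or_lt with h0 | h0
  · rw [← h0, mul_zero]; exact hT
  · have hd : (0 : ℝ) ≤ ((q ^ S.card).descFactorial k : ℝ) := Nat.cast_nonneg _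
    have := mul_le_mul_of_nonneg_left hcs hd
    have h2 := mul_le_mul_of_nonneg_right hlow hT
    nlinarith

/-- The operator that permutes, at each site `s`, the copies by `p s`. -/
def permOp (q : ℕ) (p : σ → Equiv.Perm (Fin k)) : Op σ q k :=
  Matrix.of fun x y => if ∀ i s, x i s = y (p s i) s then 1 else 0

theorem permOp_glue (S : Finset σ) (p : σ → Equiv.Perm (Fin k))
    (y z : Fin k → {s // s ∈ S} → Fin q) (r s : Fin k → {s // s ∉ S} → Fin q) :
    permOp q p (glue S y r) (glue S z s) =
      if (∀ (t : {s // s ∈ S}) i, y i t = z (p t i) t) ∧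
        r = (fun i (t : {s // s ∉ S}) => s (p t i) t) then 1 else 0 := by
  simp only [permOp, Matrix.of_apply]
  refine if_congr ⟨fun h => ⟨fun t i => ?_, ?_⟩, fun h i t => ?_⟩ rfl rfl
  · simpa only [glue_mem] using h i t
  · ext1 i; ext1 t
    simpa only [glue_not_mem] using h i t
  · by_cases ht : t ∈ S
    · have := h.1 ⟨t, ht⟩ i
      rwa [← glue_mem S y r i ⟨t, ht⟩, ← glue_mem S z s _ ⟨t, ht⟩] at this
    · have := congrFun (congrFun h.2 i) ⟨t, ht⟩
      rwa [← glue_not_mem S y r i ⟨t, ht⟩, ← glue_not_mem S z s _ ⟨t, ht⟩] at this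

/-- Overlapping with π on `S` turns the operator of `p c` into its restriction off `S`, weighted by
the number of tuples on `S` where π and `p c` agree. For each π, the Schur test bounds the weighted
sum, with `B` bounding the row sums of the Gram matrix off `S`. -/
theorem descFactorial_mul_hsSq_twirl_sum_permOp_le {S : Finset σ} (hk : k ≤ q ^ S.card)
    {C : Type*} [Fintype C] (p : C → σ → Equiv.Perm (Fin k)) (v : C → ℂ) (B : ℝ)
    (hB : ∀ c, ∑ c', ((∏ t : {s // s ∉ S}, agreeCount (Fin q) (p c t) (p c' t) : ℕ) : ℝ) ≤ B) :
    ((q ^ S.card).descFactorial k : ℝ) * hsSq (twirl S q k (∑ c, v c • permOp q (p c))) ≤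
      B * ∑ c, ‖v c‖ ^ 2 * ∑ π : Equiv.Perm (Fin k),
        ((∏ t : {s // s ∈ S}, agreeCount (Fin q) π (p c t) : ℕ) : ℝ) ^ 2 := by
  refine (descFactorial_mul_hsSq_twirl_le hk _).trans ?_
  simp only [Finset.mul_sum]
  rw [Finset.sum_comm (s := Finset.univ (α := C))]
  refine Finset.sum_le_sum fun π _ => ?_
  let f : C → (Fin k → {s // s ∉ S} → Fin q) → (Fin k → {s // s ∉ S} → Fin q) :=
    fun c s i t => s (p c t i) t
  let α : C → ℕ := fun c => ∏ t : {s // s ∈ S}, agreeCount (Fin q) π (p c t)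
  have hov : ∀ s r, (∑ z : Fin k → {s // s ∈ S} → Fin q,
      (∑ c, v c • permOp q (p c)) (glue S (z ∘ π) r) (glue S z s)) =
      ∑ c, if r = f c s then v c * α c else 0 := by
    intro s r
    simp only [Matrix.sum_apply, Matrix.smul_apply, smul_eq_mul, permOp_glue]
    rw [Finset.sum_comm]
    refine Finset.sum_congr rfl fun c _ => ?_
    rw [← Finset.mul_sum]
    by_cases hr : r = f c s
    · rw [if_pos hr]
      congr 1
      have hα : α c = Fintype.card {y : Fin k → {s // s ∈ S} → Fin q //
          ∀ t i, y (π i) t = y (p c t i) t} :=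
        (card_agree_pi (fun _ : {s // s ∈ S} => π) fun t => p c t).symm
      rw [hα, Fintype.card_subtype, ← Finset.sum_boole]
      refine Finset.sum_congr rfl fun z _ => ?_
      exact if_congr ⟨fun h => h.1, fun h => ⟨h, hr⟩⟩ rfl rfl
    · rw [if_neg hr, Finset.sum_eq_zero, mul_zero]
      intro z _
      exact if_neg fun h => hr h.2
  simp only [hov]
  refine (sum_norm_sq_le_of_agree f (fun c => v c * α c) B fun c => ?_).trans (le_of_eq ?_)
  · refine le_trans (le_of_eq ?_) (hB c)
    refine Finset.sum_congr rfl fun c' _ => ?_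
    rw [← card_agree_pi]
    congr 1
    refine Fintype.card_congr (Equiv.subtypeEquivRight fun s => ?_)
    simp only [f, funext_iff]
    exact forall_comm
  · rw [Finset.mul_sum]
    refine Finset.sum_congr rfl fun c _ => ?_
    rw [norm_mul, mul_pow, Complex.norm_natCast]

/-- Schur–Weyl duality is used twice: invariance on `S` expands the blocks, and invariance on `T`
makes each block coefficient commute with unitaries on the complement. Each use contributes one
falling factorial. -/
theorem exists_eq_sum_permOp {S T : Finset σ} (hST : ∀ s, s ∉ S ↔ s ∈ T) (hS : k ≤ q ^ S.card)
    (hT : k ≤ q ^ T.card) {X : Op σ q k} (hXS : IsTwirlInvariant S X)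
    (hXT : IsTwirlInvariant T X) :
    ∃ c : Equiv.Perm (Fin k) × Equiv.Perm (Fin k) → ℂ,
      X = ∑ g, c g • permOp q (fun s => if s ∈ S then g.1 else g.2) ∧
      ((q ^ S.card).descFactorial k : ℝ) * (((q ^ T.card).descFactorial k : ℝ) *
        ∑ g, ‖c g‖ ^ 2) ≤ hsSq X := by
  obtain ⟨x₀, hx₀⟩ := exists_injective_tuple hS
  obtain ⟨y₁, hy₁⟩ := exists_injective_tuple hT
  let e := complEquiv S T hST q
  let y₀ : Fin k → {s // s ∉ S} → Fin q := fun i => e.symm (y₁ i)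
  have hy₀ : Function.Injective y₀ := e.symm.injective.comp hy₁
  have hcomm : ∀ (π : Equiv.Perm (Fin k)) (V : Matrix.unitaryGroup ({s // s ∉ S} → Fin q) ℂ),
      tensorPow k V.1 * blockCoeff S X x₀ π = blockCoeff S X x₀ π * tensorPow k V.1 := by
    intro π V
    have hV : V.1.submatrix e.symm e.symm ∈ Matrix.unitaryGroup ({s // s ∈ T} → Fin q) ℂ := by
      rw [Matrix.mem_unitaryGroup_iff, Matrix.star_eq_conjTranspose,
        Matrix.conjTranspose_submatrix, Matrix.submatrix_mul_equiv,
        ← Matrix.star_eq_conjTranspose, Matrix.mem_unitaryGroup_iff.1 V.2,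
        Matrix.submatrix_one_equiv]
    have hVe : (V.1.submatrix e.symm e.symm).submatrix (complEquiv S T hST q)
        (complEquiv S T hST q) = V.1 := by
      ext a b
      simp [e]
    ext r s
    have h1 := congrFun (congrFun (hXT ⟨_, hV⟩) (glue S (x₀ ∘ π) r)) (glue S x₀ s)
    rw [Matrix.mul_apply, Matrix.mul_apply, sum_glue S, sum_glue S] at h1
    simpa [siteRep_compl_glue hST, hVe, Matrix.mul_apply, blockCoeff] using h1
  have hexp : ∀ π r s, blockCoeff S X x₀ π r s = ∑ τ : Equiv.Perm (Fin k),
      if r = s ∘ τ then blockCoeff S X x₀ π (y₀ ∘ τ) y₀ else 0 := fun π r s =>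
    eq_sum_perm_of_commute (hcomm π) hy₀ r s
  refine ⟨fun g => blockCoeff S X x₀ g.1 (y₀ ∘ g.2) y₀, ?_, ?_⟩
  · ext x y
    obtain ⟨x, r, rfl⟩ := exists_glue S x
    obtain ⟨y, s, rfl⟩ := exists_glue S y
    rw [hXS.apply_glue hx₀, Matrix.sum_apply, Fintype.sum_prod_type]
    refine Finset.sum_congr rfl fun π _ => ?_
    simp only [Matrix.smul_apply, permOp_glue, smul_eq_mul]
    have h1 : (∀ (t : {s // s ∈ S}) i, x i t = y ((if (t : σ) ∈ S then π else π) i) t) ↔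
        x = y ∘ π := by
      simp only [funext_iff, ite_self, Function.comp_apply]
      exact forall_comm
    have h2 : ∀ τ : Equiv.Perm (Fin k),
        ((∀ (t : {s // s ∈ S}) i, x i t = y ((if (t : σ) ∈ S then π else τ) i) t) ∧
          r = fun i (t : {s // s ∉ S}) => s ((if (t : σ) ∈ S then π else τ) i) t) ↔
        x = y ∘ π ∧ r = s ∘ τ := by
      intro τ
      refine and_congr (Iff.trans ?_ h1) ?_
      · refine forall_congr' fun t => ?_
        rw [if_pos t.2, if_pos t.2]
      · have : (fun i (t : {s // s ∉ S}) => s ((if (t : σ) ∈ S then π else τ) i) t) = s ∘ τ := by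
          ext1 i; ext1 t
          rw [if_neg t.2]
          rfl
        rw [this]
    simp only [h2]
    rw [hexp]
    by_cases hx : x = y ∘ π <;> simp [hx]
  · refine le_trans ?_ (hXS.descFactorial_mul_sum_le hx₀)
    refine mul_le_mul_of_nonneg_left ?_ (Nat.cast_nonneg _)
    rw [Fintype.sum_prod_type, Finset.mul_sum]
    refine Finset.sum_le_sum fun π _ => ?_
    have hcard : q ^ T.card = Fintype.card ({s // s ∉ S} → Fin q) := by
      rw [Fintype.card_congr e]; simp
    rw [hcard]
    refine (descFactorial_mul_le_sum_perm _).trans (le_of_eq ?_)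
    refine Finset.sum_congr rfl fun s _ => Finset.sum_congr rfl fun r _ => ?_
    rw [hexp π r s]

end Blocks

/-! ### Comparison of a partial twirl with the full twirl. -/

section Twirls

variable {σ : Type*} [Fintype σ] [DecidableEq σ] {q k : ℕ}

theorem IsTwirlInvariant.sub {S : Finset σ} {X Y : Op σ q k} (hX : IsTwirlInvariant S X)
    (hY : IsTwirlInvariant S Y) : IsTwirlInvariant S (X - Y) := fun U => by
  rw [Matrix.mul_sub, Matrix.sub_mul, hX U, hY U]

/-- `U ⊗ 1` is itself a unitary on all sites. -/
theorem IsTwirlInvariant.of_univ {X : Op σ q k} (h : IsTwirlInvariant Finset.univ X)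
    (S : Finset σ) : IsTwirlInvariant S X := by
  intro U
  let e : ({s // s ∈ (Finset.univ : Finset σ)} → Fin q) ≃ (σ → Fin q) :=
    (Equiv.subtypeUnivEquiv fun s => Finset.mem_univ s).arrowCongr (Equiv.refl _)
  have hU : (embed S U.1).submatrix e e ∈
      Matrix.unitaryGroup ({s // s ∈ (Finset.univ : Finset σ)} → Fin q) ℂ := by
    rw [Matrix.mem_unitaryGroup_iff, Matrix.star_eq_conjTranspose,
      Matrix.conjTranspose_submatrix, Matrix.submatrix_mul_equiv, ← embed_conjTranspose,
      ← embed_mul, ← Matrix.star_eq_conjTranspose, Matrix.mem_unitaryGroup_iff.1 U.2, embed_one,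
      Matrix.submatrix_one_equiv]
  have hrep : siteRep Finset.univ k ((embed S U.1).submatrix e e) = siteRep S k U.1 := by
    unfold siteRep
    congr 1
    ext x y
    rw [embed_apply, if_pos fun s hs => absurd (Finset.mem_univ s) hs, mul_one]
    rfl
  have h1 := h ⟨_, hU⟩
  rwa [hrep] at h1

theorem isTwirlInvariant_permOp_const (π : Equiv.Perm (Fin k)) :
    IsTwirlInvariant Finset.univ (permOp (σ := σ) q fun _ => π) := by
  intro U
  ext x y
  have h1 : ∀ x y : Fin k → σ → Fin q, permOp q (fun _ => π) x y = if x = y ∘ π then 1 else 0 := by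
    intro x y
    simp only [permOp, Matrix.of_apply, funext_iff, Function.comp_apply]
  have h2 : ∀ x z : Fin k → σ → Fin q, x = z ∘ π ↔ z = x ∘ π.symm := by
    intro x z
    rw [Equiv.eq_comp_symm, eq_comm]
  simp only [Matrix.mul_apply, h1, mul_ite, mul_one, mul_zero, Finset.sum_ite_eq',
    Finset.mem_univ, if_true, ite_mul, one_mul, zero_mul]
  simp only [h2 x, Finset.sum_ite_eq', Finset.mem_univ, if_true]
  simp only [siteRep, tensorPow, Matrix.of_apply, Function.comp_apply]
  exact Fintype.prod_equiv π _ _ fun i => by simp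

/-- The difference D is invariant under both twirls, so pairing with D removes them all and ⟨D, D⟩ =
0. -/
theorem twirl_univ_twirl (S : Finset σ) (X : Op σ q k) :
    twirl Finset.univ q k (twirl S q k X) = twirl Finset.univ q k X := by
  have hD : IsTwirlInvariant Finset.univ
      (twirl Finset.univ q k (twirl S q k X) - twirl Finset.univ q k X) :=
    (isTwirlInvariant_twirl _ _).sub (isTwirlInvariant_twirl _ _)
  refine sub_eq_zero.1 (eq_zero_of_hsSq_eq_zero ?_)
  rw [← Complex.ofReal_eq_zero, ← hsInner_self]
  conv_lhs => rw [map_sub, hsInner_twirl hD, hsInner_twirl hD, hsInner_twirl (hD.of_univ S)]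
  exact sub_self _

/-- Pythagoras: the full twirl of `Y` is the orthogonal projection of its partial twirl, so the left
side equals a difference of squared norms. -/
theorem hsSq_twirl_sub_twirl_univ_le (S : Finset σ) (Y : Op σ q k) :
    hsSq (twirl S q k Y - twirl Finset.univ q k Y) ≤ hsSq (twirl S q k Y) := by
  have hR := isTwirlInvariant_twirl (q := q) (k := k) Finset.univ Y
  have h1 : hsInner (twirl Finset.univ q k Y) (twirl S q k Y) =
      (hsSq (twirl Finset.univ q k Y) : ℂ) := by
    rw [hsInner_twirl (hR.of_univ S), ← hsInner_self, hsInner_twirl hR]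
  have h2 : hsInner (twirl S q k Y) (twirl Finset.univ q k Y) =
      (hsSq (twirl Finset.univ q k Y) : ℂ) := by
    rw [← star_hsInner, h1]
    exact Complex.conj_ofReal _
  have h3 : (hsSq (twirl S q k Y - twirl Finset.univ q k Y) : ℂ) =
      (hsSq (twirl S q k Y) - hsSq (twirl Finset.univ q k Y) : ℝ) := by
    rw [← hsInner_self, hsInner_sub_left, map_sub, map_sub, hsInner_self, hsInner_self, h1, h2]
    push_cast
    ring
  have h4 := Complex.ofReal_injective h3
  have := hsSq_nonneg (twirl Finset.univ q k Y)
  linarith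

end Twirls

/-! ### The crosstwirl estimate. -/

section Bipartite

variable {q m l k : ℕ}

theorem not_mem_sitesA_iff (s : Fin m ⊕ Fin m) : s ∉ sitesA m ↔ s ∈ sitesB m := by
  cases s <;> simp [sitesA, sitesB]

theorem prod_sitesFirst {M : Type*} [CommMonoid M] (hl : l ≤ m) (a b : M) :
    ∏ s : {s // s ∈ sitesFirst m l}, (if (s : Fin m ⊕ Fin m) ∈ sitesA m then a else b) =
      (a * b) ^ l := by
  rw [Finset.prod_coe_sort (sitesFirst m l) fun s => if s ∈ sitesA m then a else b, sitesFirst,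
    Finset.prod_filter, Fintype.prod_sum_type, mul_pow]
  have h : (Finset.univ.filter fun i : Fin m => (i : ℕ) < l).card = l := by
    simp [Fin.card_filter_val_lt, hl]
  simp [sitesA, ← Finset.prod_filter, h]

theorem prod_compl_sitesFirst {M : Type*} [CommMonoid M] (hl : l ≤ m) (a b : M) :
    ∏ s : {s // s ∉ sitesFirst m l}, (if (s : Fin m ⊕ Fin m) ∈ sitesA m then a else b) =
      (a * b) ^ (m - l) := by
  rw [← Finset.prod_subtype (Finset.univ.filter fun s => s ∉ sitesFirst m l) (by simp)
    fun s => if s ∈ sitesA m then a else b,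
    Finset.prod_filter, Fintype.prod_sum_type, mul_pow]
  have h : (Finset.univ.filter fun i : Fin m => l ≤ (i : ℕ)).card = m - l := by
    have h1 := Finset.card_filter_add_card_filter_not (s := (Finset.univ : Finset (Fin m)))
      (p := fun i : Fin m => (i : ℕ) < l)
    simp only [Fin.card_filter_val_lt, not_lt, Finset.card_univ, Fintype.card_fin] at h1
    omega
  simp [sitesA, sitesFirst, ← Finset.prod_filter, h]

theorem card_sitesA : (sitesA m).card = m := by
  rw [sitesA, Finset.card_filter, Fintype.sum_sum_type]
  simp

theorem card_sitesB : (sitesB m).card = m := by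
  rw [sitesB, Finset.card_filter, Fintype.sum_sum_type]
  simp

theorem card_sitesFirst (hl : l ≤ m) : (sitesFirst m l).card = 2 * l := by
  have h : (Finset.univ.filter fun i : Fin m => (i : ℕ) < l).card = l := by
    simp [Fin.card_filter_val_lt, hl]
  rw [Finset.card_filter] at h
  rw [sitesFirst, Finset.card_filter, Fintype.sum_sum_type]
  exact (congrArg₂ (· + ·) h h).trans (two_mul l).symm

/-- The full twirl absorbs the product twirl, so Q P - R = (Q - R) P. -/
theorem angle_map_apply (X : Op (Fin m ⊕ Fin m) q k) :
    (crossTwirl q m l k ∘ₗ productTwirl q m k - fullTwirl q m k) X =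
      twirl (sitesFirst m l) q k (productTwirl q m k X) -
        twirl Finset.univ q k (productTwirl q m k X) := by
  simp only [LinearMap.sub_apply, LinearMap.comp_apply, crossTwirl, fullTwirl, productTwirl,
    twirl_univ_twirl]

theorem hsSq_productTwirl_le (X : Op (Fin m ⊕ Fin m) q k) :
    hsSq (productTwirl q m k X) ≤ hsSq X :=
  (hsSq_twirl_le (sitesA m) (twirl (sitesB m) q k X)).trans (hsSq_twirl_le (sitesB m) X)

theorem hsSq_angle_map_le_self (X : Op (Fin m ⊕ Fin m) q k) :
    hsSq ((crossTwirl q m l k ∘ₗ productTwirl q m k - fullTwirl q m k) X) ≤ hsSq X := by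
  rw [angle_map_apply]
  exact (hsSq_twirl_sub_twirl_univ_le _ _).trans
    ((hsSq_twirl_le _ _).trans (hsSq_productTwirl_le X))

/-- Products of permutation operators with distinct factors on `A` and `B` are nearly annihilated
by the crosstwirl. -/
theorem hsSq_crossTwirl_le (hl : l ≤ m) (hk : k ≤ q ^ (2 * l))
    (v : Equiv.Perm (Fin k) × Equiv.Perm (Fin k) → ℂ) (hv : ∀ g, g.1 = g.2 → v g = 0) :
    ((q ^ (2 * l)).descFactorial k : ℝ) * hsSq (twirl (sitesFirst m l) q k
        (∑ g, v g • permOp q (fun s => if s ∈ sitesA m then g.1 else g.2))) ≤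
      ((q ^ (m - l)).ascFactorial k : ℝ) ^ 2 *
        ((((q ^ (2 * l)).ascFactorial k : ℝ) ^ 2 - (((q : ℝ) ^ (2 * l)) ^ k) ^ 2) *
          ∑ g, ‖v g‖ ^ 2) := by
  rw [← card_sitesFirst hl] at hk
  have hA : ∀ (n : ℕ) (σ : Equiv.Perm (Fin k)),
      ∑ τ, agreeCount (Fin q) σ τ ^ n = (q ^ n).ascFactorial k := by
    intro n σ
    rw [← factorial_mul_choose_eq_ascFactorial, ← sum_agreeCount_fin (q ^ n) σ]
    simp only [agreeCount_fin_pow]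
  have key := descFactorial_mul_hsSq_twirl_sum_permOp_le hk
    (fun (g : Equiv.Perm (Fin k) × Equiv.Perm (Fin k)) (s : Fin m ⊕ Fin m) =>
      if s ∈ sitesA m then g.1 else g.2) v (((q ^ (m - l)).ascFactorial k : ℝ) ^ 2) (by
      intro g
      refine le_of_eq ?_
      -- Off the crosstwirl there are `m - l` sites on each side, so the row sum factors into an A
      -- part and a B part, each a rising factorial of `q ^ (m - l)`.
      have hprod : ∀ g' : Equiv.Perm (Fin k) × Equiv.Perm (Fin k),
          ∏ t : {s // s ∉ sitesFirst m l}, agreeCount (Fin q)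
            (if (t : Fin m ⊕ Fin m) ∈ sitesA m then g.1 else g.2)
            (if (t : Fin m ⊕ Fin m) ∈ sitesA m then g'.1 else g'.2) =
          agreeCount (Fin q) g.1 g'.1 ^ (m - l) * agreeCount (Fin q) g.2 g'.2 ^ (m - l) := by
        intro g'
        rw [← mul_pow, ← prod_compl_sitesFirst hl]
        refine Finset.prod_congr rfl fun t _ => ?_
        split_ifs <;> rfl
      simp only [hprod]
      rw [← Nat.cast_sum, Fintype.sum_prod_type]
      simp only [← Finset.mul_sum, hA, ← Finset.sum_mul]
      push_cast
      ring)
  rw [card_sitesFirst hl] at key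
  refine key.trans (mul_le_mul_of_nonneg_left ?_ (by positivity))
  rw [Finset.mul_sum]
  refine Finset.sum_le_sum fun g _ => ?_
  by_cases hg : g.1 = g.2
  · simp [hv g hg]
  · rw [mul_comm]
    refine mul_le_mul_of_nonneg_right ?_ (by positivity)
    -- The crosstwirl has `l` sites on each side; squaring the weight turns exponent `l` into `2 *
    -- l`, the Gram entries in dimension `q ^ (2 * l)`.
    have hprod : ∀ π : Equiv.Perm (Fin k),
        (∏ t : {s // s ∈ sitesFirst m l}, agreeCount (Fin q) π
          (if (t : Fin m ⊕ Fin m) ∈ sitesA m then g.1 else g.2)) ^ 2 =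
        agreeCount (Fin (q ^ (2 * l))) π g.1 * agreeCount (Fin (q ^ (2 * l))) π g.2 := by
      intro π
      rw [agreeCount_fin_pow, agreeCount_fin_pow, ← mul_pow, mul_comm 2 l, pow_mul,
        ← prod_sitesFirst hl]
      congr 1
      refine Finset.prod_congr rfl fun t _ => ?_
      split_ifs <;> rfl
    have h1 := sum_agreeCount_mul_agreeCount_le (ι := Fin (q ^ (2 * l))) hg
    rw [Fintype.card_fin, factorial_mul_choose_eq_ascFactorial] at h1
    rw [le_sub_iff_add_le]
    simp only [← Nat.cast_pow, hprod, ← Nat.cast_sum]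
    exact_mod_cast h1

theorem hsSq_angle_map_le (hq : 1 ≤ q) (hl : l ≤ m) (hkd : k ≤ q ^ (2 * l)) (hkD : k ≤ q ^ m)
    (hy : 0 < 1 - (k : ℝ) ^ 2 / (2 * (q : ℝ) ^ (2 * l)))
    (hx : 0 < 1 - (k : ℝ) ^ 2 / (2 * (q : ℝ) ^ m)) (X : Op (Fin m ⊕ Fin m) q k) :
    hsSq ((crossTwirl q m l k ∘ₗ productTwirl q m k - fullTwirl q m k) X) ≤
      ((1 - (k : ℝ) ^ 2 / (2 * (q : ℝ) ^ m)) ^ 2)⁻¹ *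
      (1 - (k : ℝ) ^ 2 / (2 * (q : ℝ) ^ (2 * l)))⁻¹ * Real.exp ((k : ℝ) ^ 2 / (q : ℝ) ^ (m - l)) *
      ((((q ^ (2 * l)).ascFactorial k : ℝ) / ((q : ℝ) ^ (2 * l)) ^ k) ^ 2 - 1) * hsSq X := by
  rw [angle_map_apply]
  set P := productTwirl q m k X with hP
  have hPA : IsTwirlInvariant (sitesA m) P := isTwirlInvariant_twirl _ _
  have hPB : IsTwirlInvariant (sitesB m) P :=
    isTwirlInvariant_twirl_of_compl not_mem_sitesA_iff (isTwirlInvariant_twirl _ _)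
  obtain ⟨c, hc, hlow⟩ := exists_eq_sum_permOp not_mem_sitesA_iff (by rwa [card_sitesA])
    (by rwa [card_sitesB]) hPA hPB
  rw [card_sitesA, card_sitesB] at hlow
  -- `Y` keeps only the terms with different permutations on A and B; `P - Y` is fully invariant and
  -- is killed by Q - R.
  let v : Equiv.Perm (Fin k) × Equiv.Perm (Fin k) → ℂ := fun g => if g.1 = g.2 then 0 else c g
  let Y : Op (Fin m ⊕ Fin m) q k :=
    ∑ g, v g • permOp q (fun s => if s ∈ sitesA m then g.1 else g.2)
  have hinv : IsTwirlInvariant Finset.univ (P - Y) := by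
    have hPY : P - Y = ∑ g : Equiv.Perm (Fin k) × Equiv.Perm (Fin k),
        (if g.1 = g.2 then c g else 0) • permOp q (fun _ => g.1) := by
      rw [hc, ← Finset.sum_sub_distrib]
      refine Finset.sum_congr rfl fun g _ => ?_
      by_cases hg : g.1 = g.2 <;> simp [v, hg]
    rw [hPY]
    intro U
    rw [Matrix.mul_sum, Matrix.sum_mul]
    refine Finset.sum_congr rfl fun g _ => ?_
    rw [Matrix.mul_smul, Matrix.smul_mul, isTwirlInvariant_permOp_const g.1 U]
  have hdiff : twirl (sitesFirst m l) q k P - twirl Finset.univ q k P =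
      twirl (sitesFirst m l) q k Y - twirl Finset.univ q k Y := by
    have h1 := twirl_eq_self (hinv.of_univ (sitesFirst m l))
    have h2 := twirl_eq_self hinv
    rw [map_sub] at h1 h2
    have h3 := h1.trans h2.symm
    rw [sub_eq_sub_iff_add_eq_add] at h3 ⊢
    rw [h3, add_comm]
  rw [hdiff]
  refine (hsSq_twirl_sub_twirl_univ_le _ _).trans ?_
  have hup := hsSq_crossTwirl_le hl hkd v fun g hg => if_pos hg
  change _ * hsSq (twirl (sitesFirst m l) q k Y) ≤ _ at hup
  set N := hsSq (twirl (sitesFirst m l) q k Y)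
  have hN : 0 ≤ N := hsSq_nonneg _
  have hX := hsSq_productTwirl_le X
  rw [← hP] at hX
  have hvc : ∑ g, ‖v g‖ ^ 2 ≤ ∑ g, ‖c g‖ ^ 2 := by
    refine Finset.sum_le_sum fun g _ => ?_
    by_cases hg : g.1 = g.2 <;> simp [v, hg]
  set C := ∑ g, ‖c g‖ ^ 2
  have hC : 0 ≤ C := by positivity
  have hq0 : (0 : ℝ) < q := by exact_mod_cast hq
  have hd := pow_mul_one_sub_le_descFactorial (pow_pos hq (2 * l)) hkd
  have hD := pow_mul_one_sub_le_descFactorial (pow_pos hq m) hkD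
  have hT := ascFactorial_le_pow_mul_exp (pow_pos hq (m - l)) k
  have hasc : (((q ^ (2 * l)) ^ k : ℕ) : ℝ) ≤ ((q ^ (2 * l)).ascFactorial k : ℝ) := by
    exact_mod_cast Nat.pow_succ_le_ascFactorial (q ^ (2 * l)) k
  push_cast at hd hD hT hasc
  set d : ℝ := (q : ℝ) ^ (2 * l) with hdd
  set D : ℝ := (q : ℝ) ^ m with hDD
  set T : ℝ := (q : ℝ) ^ (m - l) with hTT
  set y : ℝ := 1 - (k : ℝ) ^ 2 / (2 * d)
  set x : ℝ := 1 - (k : ℝ) ^ 2 / (2 * D)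
  set A : ℝ := ((q ^ (2 * l)).ascFactorial k : ℝ)
  set G : ℝ := Real.exp ((k : ℝ) ^ 2 / T) with hG
  have hd0 : 0 < d := by positivity
  have hD0 : 0 < D := by positivity
  have hT0 : 0 < T := by positivity
  -- This identity makes all powers of the dimensions cancel, apart from the normalization of `A`.
  have hTd : T ^ 2 * d = D ^ 2 := by
    rw [hTT, hdd, hDD, ← pow_mul, ← pow_mul, ← pow_add]
    congr 1
    omega
  have hG2 : Real.exp ((k : ℝ) ^ 2 / (2 * T)) ^ 2 = G := by
    rw [hG, ← Real.exp_nat_mul]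
    congr 1
    push_cast
    field_simp
  have hT2 : ((q ^ (m - l)).ascFactorial k : ℝ) ^ 2 ≤ (T ^ k) ^ 2 * G := by
    rw [← hG2, ← mul_pow]
    exact pow_le_pow_left₀ (Nat.cast_nonneg _) hT 2
  have hAd : 0 ≤ A ^ 2 - (d ^ k) ^ 2 := sub_nonneg.2 (pow_le_pow_left₀ (by positivity) hasc 2)
  have h1 : d ^ k * y * N ≤ (T ^ k) ^ 2 * G * ((A ^ 2 - (d ^ k) ^ 2) * C) :=
    calc d ^ k * y * N ≤ _ := mul_le_mul_of_nonneg_right hd hN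
      _ ≤ _ := hup
      _ ≤ _ := mul_le_mul hT2 (mul_le_mul_of_nonneg_left hvc hAd) (by positivity) (by positivity)
  have h2 : (D ^ k * x) * ((D ^ k * x) * C) ≤ hsSq X :=
    calc (D ^ k * x) * ((D ^ k * x) * C) ≤ _ :=
          mul_le_mul hD (mul_le_mul_of_nonneg_right hD hC) (by positivity) (Nat.cast_nonneg _)
      _ ≤ _ := hlow
      _ ≤ _ := hX
  have hTdk : (T ^ k) ^ 2 * d ^ k = (D ^ k) ^ 2 := by
    rw [← pow_mul, mul_comm k 2, pow_mul, ← mul_pow, hTd, ← pow_mul, mul_comm 2 k, pow_mul]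
  have hC2 : C ≤ hsSq X / ((D ^ k) ^ 2 * x ^ 2) := by
    rw [le_div_iff₀ (by positivity)]
    linarith
  have h3 : d ^ k * y * N ≤
      (T ^ k) ^ 2 * G * ((A ^ 2 - (d ^ k) ^ 2) * (hsSq X / ((D ^ k) ^ 2 * x ^ 2))) :=
    h1.trans (by gcongr)
  rw [← le_div_iff₀' (by positivity)] at h3
  refine h3.trans (le_of_eq ?_)
  rw [← hTdk]
  field_simp

end Bipartite

/-! ### From squared norms to the subspace angle. -/

section Norm

attribute [local instance] Matrix.frobeniusNormedAddCommGroup Matrix.frobeniusNormedSpace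

theorem frobenius_norm_sq_eq_hsSq {ι : Type*} [Fintype ι] (X : Matrix ι ι ℂ) :
    ‖X‖ ^ 2 = hsSq X := by
  rw [Matrix.frobenius_norm_def, ← Real.sqrt_eq_rpow, Real.sq_sqrt (by positivity), hsSq,
    Finset.sum_comm]
  norm_cast

theorem subspaceAngle_sq_le {q m l k : ℕ} {K : ℝ} (hK : 0 ≤ K)
    (h : ∀ X : Op (Fin m ⊕ Fin m) q k,
      hsSq ((crossTwirl q m l k ∘ₗ productTwirl q m k - fullTwirl q m k) X) ≤ K * hsSq X) :
    subspaceAngle q m l k ^ 2 ≤ K := by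
  have h1 : subspaceAngle q m l k ≤ √K := by
    unfold subspaceAngle opNorm
    refine ContinuousLinearMap.opNorm_le_bound _ (Real.sqrt_nonneg _) fun X => ?_
    rw [← Real.sqrt_sq (norm_nonneg X), ← Real.sqrt_mul hK, frobenius_norm_sq_eq_hsSq]
    refine Real.le_sqrt_of_sq_le ?_
    rw [frobenius_norm_sq_eq_hsSq]
    exact h X
  have h0 : 0 ≤ subspaceAngle q m l k := by
    unfold subspaceAngle opNorm
    exact norm_nonneg _
  calc _ ≤ √K ^ 2 := pow_le_pow_left₀ h0 h1 2
    _ = K := Real.sq_sqrt hK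

end Norm

end CrossTwirl

end

theorem mainTheorem7 (q m l k : ℕ) (hq : 1 ≤ q) (hl : l < m)
    (hk : k ≤ min (q ^ (2 * l)) (q ^ m)) (hk2 : k ^ 2 < 2 * q ^ (2 * l))
    (hne : k ^ 2 ≠ 2 * q ^ m)
    (a b c g : ℝ)
    (ha : a = ((1 - (k : ℝ) ^ 2 / (2 * (q : ℝ) ^ m)) ^ 2)⁻¹)
    (hb : b = Real.exp (-((k : ℝ) ^ 2 / (2 * (q : ℝ) ^ (2 * m)))))
    (hc : c = (1 - (k : ℝ) ^ 2 / (2 * (q : ℝ) ^ (2 * l)))⁻¹)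
    (hg : g = Real.exp ((k : ℝ) ^ 2 / (q : ℝ) ^ (m - l))) :
    CrossTwirl.subspaceAngle q m l k ^ 2 ≤
      a * c * g * ((q : ℝ) ^ (4 * l * k))⁻¹ * (k.factorial : ℝ) ^ 2
          * ((q ^ (2 * l) + k - 1).choose k : ℝ) ^ 2
        - 2 * a * b * ((q : ℝ) ^ (4 * m * k))⁻¹ * (k.factorial : ℝ) ^ 2
          * ((q ^ (2 * m) + k - 1).choose k : ℝ) ^ 2
        + a * b * ((q : ℝ) ^ (4 * m * k))⁻¹ * (k.factorial : ℝ) ^ 4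
          * ((q ^ m + k - 1).choose k : ℝ) ^ 4 := by
  have hq0 : (0 : ℝ) < q := by exact_mod_cast hq
  set A₁ : ℝ := ((q ^ (2 * l)).ascFactorial k : ℝ) / ((q : ℝ) ^ (2 * l)) ^ k with hA₁
  -- The base is written as a square to match `ascFactorial_sq_div_le`, which gives `A₂ ≤ A₃`.
  set A₂ : ℝ := (((q ^ m) ^ 2).ascFactorial k : ℝ) / (((q ^ m : ℕ) : ℝ) ^ 2) ^ k with hA₂
  set A₃ : ℝ := ((q ^ m).ascFactorial k : ℝ) / ((q ^ m : ℕ) : ℝ) ^ k with hA₃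
  have hA₂₃ : A₂ ≤ A₃ := CrossTwirl.ascFactorial_sq_div_le (pow_pos hq m) k
  have hA₂0 : 0 ≤ A₂ := by positivity
  have hA₁1 : 1 ≤ A₁ := by
    rw [hA₁, one_le_div (by positivity)]
    exact_mod_cast Nat.pow_succ_le_ascFactorial (q ^ (2 * l)) k
  have hrhs : a * c * g * ((q : ℝ) ^ (4 * l * k))⁻¹ * (k.factorial : ℝ) ^ 2
          * ((q ^ (2 * l) + k - 1).choose k : ℝ) ^ 2
        - 2 * a * b * ((q : ℝ) ^ (4 * m * k))⁻¹ * (k.factorial : ℝ) ^ 2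
          * ((q ^ (2 * m) + k - 1).choose k : ℝ) ^ 2
        + a * b * ((q : ℝ) ^ (4 * m * k))⁻¹ * (k.factorial : ℝ) ^ 4
          * ((q ^ m + k - 1).choose k : ℝ) ^ 4 =
      a * (c * g * A₁ ^ 2 - 2 * b * A₂ ^ 2 + b * A₃ ^ 4) := by
    rw [hA₁, hA₂, hA₃, ← pow_mul q m 2, mul_comm m 2]
    simp only [← CrossTwirl.factorial_mul_choose_eq_ascFactorial, Nat.cast_mul, Nat.cast_pow,
      div_pow, mul_pow, ← pow_mul]
    rw [show 2 * l * k * 2 = 4 * l * k by ring, show m * k * 4 = 4 * m * k by ring,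
      show m * 2 * k * 2 = 4 * m * k by ring]
    field_simp
  rw [hrhs]
  have hy : 0 < 1 - (k : ℝ) ^ 2 / (2 * (q : ℝ) ^ (2 * l)) := by
    rw [sub_pos, div_lt_one (by positivity)]
    exact_mod_cast hk2
  have hc1 : 1 ≤ c := by
    rw [hc]
    refine (one_le_inv₀ hy).2 ?_
    have : 0 ≤ (k : ℝ) ^ 2 / (2 * (q : ℝ) ^ (2 * l)) := by positivity
    linarith
  have hg1 : 1 ≤ g := by
    rw [hg]
    exact Real.one_le_exp (by positivity)
  have hb1 : b ≤ 1 := by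
    rw [hb]
    exact Real.exp_le_one_iff.2 (neg_nonpos.2 (by positivity))
  have hb0 : 0 ≤ b := by rw [hb]; exact (Real.exp_pos _).le
  have ha0 : 0 ≤ a := by rw [ha]; positivity
  have hcg : 1 ≤ c * g := one_le_mul_of_one_le_of_one_le hc1 hg1
  -- A₃⁴ - 2A₂² ≥ A₂⁴ - 2A₂² = (A₂² - 1)² - 1 ≥ -1, and 0 ≤ b ≤ 1.
  have htail : -1 ≤ - 2 * b * A₂ ^ 2 + b * A₃ ^ 4 := by
    have h1 : A₂ ^ 4 ≤ A₃ ^ 4 := pow_le_pow_left₀ hA₂0 hA₂₃ 4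
    have h2 : -1 ≤ A₃ ^ 4 - 2 * A₂ ^ 2 := by linarith [sq_nonneg (A₂ ^ 2 - 1)]
    have h3 : b * -1 ≤ b * (A₃ ^ 4 - 2 * A₂ ^ 2) := mul_le_mul_of_nonneg_left h2 hb0
    linarith
  -- For positive `hx` the coefficient estimate applies; otherwise contractivity suffices.
  by_cases hx : 0 < 1 - (k : ℝ) ^ 2 / (2 * (q : ℝ) ^ m)
  · have hbound := CrossTwirl.subspaceAngle_sq_le (q := q) (m := m) (l := l) (k := k)
      (K := a * c * g * (A₁ ^ 2 - 1)) (mul_nonneg (by positivity)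
        (sub_nonneg.2 (one_le_pow₀ hA₁1))) (by
        intro X
        rw [ha, hc, hg]
        exact CrossTwirl.hsSq_angle_map_le hq hl.le (hk.trans (min_le_left _ _))
          (hk.trans (min_le_right _ _)) hy hx X)
    refine hbound.trans ?_
    rw [mul_assoc, mul_assoc]
    refine mul_le_mul_of_nonneg_left ?_ ha0
    linarith
  · have hbound := CrossTwirl.subspaceAngle_sq_le (q := q) (m := m) (l := l) (k := k)
      (K := 1) zero_le_one fun X => by
        rw [one_mul]
        exact CrossTwirl.hsSq_angle_map_le_self X
    refine hbound.trans ?_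
    set x : ℝ := (k : ℝ) ^ 2 / (2 * (q : ℝ) ^ m) with hxx
    -- x = 1 is excluded because `a` would then be the inverse of zero.
    have hx1 : 1 < x := by
      refine lt_of_le_of_ne (by linarith) fun h => hne ?_
      rw [hxx, eq_div_iff (by positivity), one_mul] at h
      exact_mod_cast h.symm
    have hgx : Real.exp (2 * x) ≤ g := by
      rw [hg, hxx]
      refine Real.exp_le_exp.2 ?_
      rw [mul_div_mul_left _ _ two_ne_zero |> (mul_div_assoc _ _ _).symm.trans]
      have : (q : ℝ) ^ (m - l) ≤ (q : ℝ) ^ m :=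
        pow_le_pow_right₀ (by exact_mod_cast hq) (Nat.sub_le m l)
      gcongr
    have hexp : 1 + 2 * x + (2 * x) ^ 2 / 2 ≤ Real.exp (2 * x) :=
      Real.quadratic_le_exp_of_nonneg (by linarith)
    have hcgA : g ≤ c * g * A₁ ^ 2 := by
      have h1 : g ≤ c * g := le_mul_of_one_le_left (by linarith) hc1
      exact h1.trans (le_mul_of_one_le_right (by linarith) (one_le_pow₀ hA₁1))
    have hpos : 0 < (1 - x) ^ 2 := by
      have : 1 - x ≠ 0 := by linarith
      positivity
    rw [ha, ← div_eq_inv_mul, one_le_div hpos]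
    -- Gives g - 1 ≥ (1 - x)² = 1/a, so the right-hand side is at least a(g - 1) ≥ 1.
    have hexp' : (1 - x) ^ 2 + 1 ≤ Real.exp (2 * x) := by linarith [sq_nonneg x]
    linarith
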